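/- Let $W=(W(t))_{t\ge 0}$ be a standard real Brownian motion on a complete probability space $(\Omega,\mathcal F,P)$, and let $(\mathcal F_t)_{t\ge0}$ be the usual augmentation (completed with the $P$-null sets and made right-continuous) of the filtration generated by $W$. Let $M\ge 1$ be an integer, $\Delta>0$, and let $g:\mathbb R^M\to\mathbb R$ be infinitely differentiable. Put $F=g(W(\Delta),W(2\Delta),\ldots,W(M\Delta))$. For such a smooth cylindrical functional the Malliavin derivative at time $s\in[0,M\Delta]$ is $$D_sF=\sum_{k=1}^{M}\partial_k g\big(W(\Delta),\ldots,W(M\Delta)\big)\,\mathbf 1_{[0,k\Delta]}(s),$$ which is again a smooth cylindrical functional for each fixed $s$; iterated derivatives $D_{s_n}\cdots D_{s_1}F$ are obtained by repeating this, and $D_s^l$ is the $l$-fold iterate of $D_s$. Assume that $F\in\mathbb D_\infty([0,M\Delta])$, i.e. $F\in L^2(\Omega)$ and $$\Big\|\sup_{s_1,\ldots,s_n\in[0,M\Delta]}|D_{s_n}\cdots D_{s_1}F|\Big\|_{L^2(\Omega)}<\infty\quad\text{for every integer } n\ge1,$$ and that for each $m\in\{0,\ldots,M-1\}$ $$\sum_{i=0}^{L}\big\|D_{(m+1)\Delta}^{2L-i}F\big\|_{L^2(\Omega)}^{2}\binom{L}{i}^{4}\frac{i!}{(L!)^{2}}\,\Delta^{2L-i}\;\longrightarrow\;0\qquad(L\to\infty).$$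 Then for each $m\in\{0,\ldots,M-1\}$ $$E[F\,|\,\mathcal F_{m\Delta}]=\sum_{l=0}^{\infty}\gamma(m,l)\,E\big[D_{(m+1)\Delta}^{l}F\,\big|\,\mathcal F_{(m+1)\Delta}\big]\quad\text{in }L^2(\Omega),$$ that is, every term of the series is in $L^2(\Omega)$ and its partial sums converge in $L^2(\Omega)$ to the left-hand side. Here $\gamma(m,0)=1$ and, for $l\ge1$, $$\gamma(m,l)=(-1)^{l}\Delta^{l/2}\sum_{j=0}^{\lfloor l/2\rfloor}\frac{1}{j!\,(l-2j)!}\,h_{l-2j}\!\left(\frac{W((m+1)\Delta)-W(m\Delta)}{\sqrt\Delta}\right),$$ where $h_n(x)=(-1)^n e^{x^2/2}\frac{d^n}{dx^n}e^{-x^2/2}$ is the $n$-th Hermite polynomial. -/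

import Mathlib

open MeasureTheory ProbabilityTheory Filter Topology
open scoped NNReal ENNReal

noncomputable section

namespace BackwardTaylor

variable {Ω : Type*} {mΩ : MeasurableSpace Ω} {P : Measure Ω} {W : ℝ≥0 → Ω → ℝ}

/-- On a complete probability space the marginals of a Brownian motion are measurable. -/
theorem measurable_eval [P.IsComplete] (hW : IsBrownianReal W P) (t : ℝ≥0) :
    Measurable (W t) :=
  (hW.aemeasurable t).nullMeasurable.measurable_of_complete

/-- The filtration generated by a Brownian motion `W`, completed with all the `P`-null sets. -/
def completedFiltration [P.IsComplete] (hW : IsBrownianReal W P) : Filtration ℝ≥0 mΩ where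
  seq t := (⨆ s ≤ t, MeasurableSpace.comap (W s) inferInstance) ⊔
    MeasurableSpace.generateFrom {A : Set Ω | P A = 0}
  mono' _ _ hst := sup_le_sup_right (biSup_mono fun _ hr => hr.trans hst) _
  le' _ := sup_le (iSup₂_le fun s _ => (measurable_eval hW s).comap_le)
    (MeasurableSpace.generateFrom_le fun A hA =>
      Measure.isComplete_iff.1 inferInstance A hA)

/-- The usual augmentation of the filtration generated by a Brownian motion `W`:
the right-continuous version `t ↦ ⋂ s > t, 𝒢 s` of its completed filtration `𝒢`. -/
def brownianFiltration [P.IsComplete] (hW : IsBrownianReal W P) : Filtration ℝ≥0 mΩ :=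
  (completedFiltration hW).rightCont

/-- The sampled path `(W(Δ), W(2Δ), …, W(MΔ))`; the coordinate `k : Fin M` is `W((k+1)Δ)`. -/
def sample (W : ℝ≥0 → Ω → ℝ) (Δ : ℝ≥0) (M : ℕ) (ω : Ω) : Fin M → ℝ :=
  fun k => W (((k : ℕ) + 1 : ℕ) * Δ) ω

/-- The Malliavin derivative at time `s` of the smooth cylindrical functional
`F = g(W(Δ), …, W(MΔ))` is the cylindrical functional
`D_s F = ∑_{k=1}^M ∂_k g(W(Δ), …, W(MΔ)) 1_{[0,kΔ]}(s)`.
This is the map that sends the function `g` to the function representing `D_s F`. -/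
def malliavin {M : ℕ} (Δ s : ℝ≥0) (g : (Fin M → ℝ) → ℝ) : (Fin M → ℝ) → ℝ :=
  fun x => ∑ k : Fin M, fderiv ℝ g x (Pi.single k 1) *
    (Set.Icc 0 (((k : ℕ) + 1 : ℕ) * Δ)).indicator (fun _ => (1 : ℝ)) s

/-- `D_{s_0} ⋯ D_{s_{n-1}} F` for `F = g(W(Δ), …, W(MΔ))`, in terms of `g`. -/
def malliavinIter {M n : ℕ} (Δ : ℝ≥0) (s : Fin n → ℝ≥0) (g : (Fin M → ℝ) → ℝ) :
    (Fin M → ℝ) → ℝ :=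
  (List.ofFn s).foldr (malliavin Δ) g

/-- The random variable `D_s^l F`, the `l`-fold Malliavin derivative at the single time `s`
of `F = g(W(Δ), …, W(MΔ))`. -/
def malliavinPow (W : ℝ≥0 → Ω → ℝ) {M : ℕ} (Δ s : ℝ≥0) (l : ℕ) (g : (Fin M → ℝ) → ℝ) :
    Ω → ℝ :=
  fun ω => ((malliavin Δ s)^[l] g) (sample W Δ M ω)

/-- `F = g(W(Δ), …, W(MΔ))` is infinitely Malliavin differentiable on `[0, MΔ]`: `F ∈ L²` and
`‖sup_{s_1, …, s_n ∈ [0, MΔ]} |D_{s_n} ⋯ D_{s_1} F|‖_{L²} < ∞` for every `n ≥ 1`. -/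
def InDInfty (P : Measure Ω) (W : ℝ≥0 → Ω → ℝ) {M : ℕ} (Δ : ℝ≥0)
    (g : (Fin M → ℝ) → ℝ) : Prop :=
  MemLp (fun ω => g (sample W Δ M ω)) 2 P ∧
  ∀ n : ℕ, 1 ≤ n →
    ∫⁻ ω, (⨆ s : Fin n → Set.Icc (0 : ℝ≥0) (M * Δ),
      ‖malliavinIter Δ (fun i => (s i : ℝ≥0)) g (sample W Δ M ω)‖ₑ) ^ 2 ∂P < ∞

/-- The quantity
`∑_{i=0}^L ‖D_s^{2L-i} F‖²_{L²} (L choose i)⁴ (i! / (L!)²) Δ^{2L-i}`. -/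
def condSum (P : Measure Ω) (W : ℝ≥0 → Ω → ℝ) {M : ℕ} (Δ s : ℝ≥0)
    (g : (Fin M → ℝ) → ℝ) (L : ℕ) : ℝ :=
  ∑ i ∈ Finset.range (L + 1),
    (eLpNorm (malliavinPow W Δ s (2 * L - i) g) 2 P).toReal ^ 2 * (L.choose i : ℝ) ^ 4 *
      ((i.factorial : ℝ) / (L.factorial : ℝ) ^ 2) * (Δ : ℝ) ^ (2 * L - i)

/-- The coefficient
`γ(m,l) = (-1)^l Δ^{l/2} ∑_{j=0}^{⌊l/2⌋} h_{l-2j}((W((m+1)Δ) - W(mΔ)) / √Δ) / (j! (l-2j)!)`,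
where `h_n` is the probabilists' Hermite polynomial. For `l = 0` it equals `1`. -/
def gammaCoeff (W : ℝ≥0 → Ω → ℝ) (Δ : ℝ≥0) (m l : ℕ) (ω : Ω) : ℝ :=
  (-1) ^ l * Real.sqrt (Δ : ℝ) ^ l * ∑ j ∈ Finset.range (l / 2 + 1),
    1 / ((j.factorial : ℝ) * ((l - 2 * j).factorial : ℝ)) *
      Polynomial.aeval ((W ((m + 1 : ℕ) * Δ) ω - W ((m : ℕ) * Δ) ω) / Real.sqrt (Δ : ℝ))
        (Polynomial.hermite (l - 2 * j))

/-- The `l`-th term `γ(m,l) E[D_{(m+1)Δ}^l F | ℱ_{(m+1)Δ}]` of the backward Taylor expansion. -/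
def bteTerm [P.IsComplete] (hW : IsBrownianReal W P) {M : ℕ} (Δ : ℝ≥0)
    (g : (Fin M → ℝ) → ℝ) (m l : ℕ) (ω : Ω) : ℝ :=
  gammaCoeff W Δ m l ω *
    (P[malliavinPow W Δ ((m + 1 : ℕ) * Δ) l g |
      brownianFiltration hW ((m + 1 : ℕ) * Δ)]) ω

end BackwardTaylor

end

/-! Freeze everything except the increment over [mΔ, (m+1)Δ]. The sampled path is v + √Δ U e, where
U is standard Gaussian, v (past plus later increments) is independent of U, and e is the indicator
of the coordinates k ≥ m. With f(u) = g(v + √Δ u e) the variable D_{(m+1)Δ}^l F is Δ^{-l/2}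
f^{(l)}(U), so the series before conditioning is ∑ (-1)^l H_l(U) f^{(l)}(U), where H_l = `heatPoly
l` has generating function exp(tx + t²/2). Formally this is exp(-xD + D²/2) f at x, that is
exp(D²/2) f at 0, which is the Gaussian mean of f.

The rigorous one-variable statement is `lintegral_backSum_sub_sq_le`, for f with ‖f^{(n)}‖² ≤ K ρ^n
n! and 7ρ < 1. Let δ be the adjoint of D in Gaussian L². Writing multiplication by a Hermite
polynomial as ∑ C(k,i) δ^i D^{k-i} (`herm_mul`) and computing ‖δ^i u‖ from the commutator Dδ - δD =
1, one bounds the squared norm of the l-th term by K (l+1)^5 (7ρ)^l; the 7 is the number of blocks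
in a multinomial coefficient. Hence the series converges in L². Since H_{l+1}' = H_l, the derivative
of a partial sum telescopes to its last term (`hasDerivAt_backSum`), which tends to 0, so the limit
is a constant. That constant is ∫ f, because the means of the partial sums rearrange an absolutely
convergent double series whose diagonals are multiples of (1-1)^l.

The assumption on F enters through `summable_of_tendsto_weighted_sum`: the summands with i near L/2
force ∑ Δ^n ‖D^n F‖² / (ρ^n n!) < ∞ for ρ = 5/36 < 1/7. This sum disintegrates over v into an
integrable constant K(v), so the one-variable bound integrates (`backSum_comp_of_indepFun`).

Finally, averaging F over U and then conditioning on the σ-algebra at (m+1)Δ gives E[F | ℱ_{mΔ}]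
(`condExp_incrementMean`), γ(m,l) can be pulled out of that conditional expectation, and conditional
expectation contracts L². -/

noncomputable section

namespace BackwardTaylor

/-! ### Gaussian weight and smooth functions with square integrable derivatives. -/

/-- The standard Gaussian measure on the line. -/
abbrev gauss : Measure ℝ := gaussianReal 0 1

theorem hasDerivAt_gaussianPDFReal (x : ℝ) :
    HasDerivAt (gaussianPDFReal 0 1) (-x * gaussianPDFReal 0 1 x) x := by
  have h : HasDerivAt (fun y : ℝ => -(y - 0) ^ 2 / (2 * ((1 : ℝ≥0) : ℝ))) (-x) x := by
    have := (((hasDerivAt_id x).sub_const 0).pow 2).neg.div_const (2 * ((1 : ℝ≥0) : ℝ))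
    refine this.congr_deriv ?_
    simp
    ring
  have h2 := (h.exp).const_mul ((√(2 * Real.pi * ((1 : ℝ≥0) : ℝ)))⁻¹)
  rw [gaussianPDFReal_def]
  refine h2.congr_deriv ?_
  ring

theorem continuous_gaussianPDFReal : Continuous (gaussianPDFReal 0 1) :=
  continuous_iff_continuousAt.2 fun x => (hasDerivAt_gaussianPDFReal x).continuousAt

theorem integrable_gauss_iff {f : ℝ → ℝ} :
    Integrable f gauss ↔ Integrable (fun x => gaussianPDFReal 0 1 x * f x) := by
  rw [gauss, gaussianReal_of_var_ne_zero _ one_ne_zero,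
    integrable_withDensity_iff_integrable_smul' (measurable_gaussianPDF _ _)
      (ae_of_all _ fun _ => gaussianPDF_lt_top)]
  simp

theorem integral_gauss_eq (f : ℝ → ℝ) :
    ∫ x, f x ∂gauss = ∫ x, gaussianPDFReal 0 1 x * f x :=
  integral_gaussianReal_eq_integral_smul one_ne_zero

/-- If `f` and `f'` are square integrable for the Gaussian measure, then so is `x f`. -/
theorem memLp_id_mul {f f' : ℝ → ℝ} (hd : ∀ x, HasDerivAt f (f' x) x) (hc : Continuous f')
    (h : MemLp f 2 gauss) (h' : MemLp f' 2 gauss) :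
    MemLp (fun x => x * f x) 2 gauss := by
  have hfc : Continuous f := continuous_iff_continuousAt.2 fun x => (hd x).continuousAt
  have hφc := continuous_gaussianPDFReal
  have hm : AEStronglyMeasurable (fun x => x * f x) gauss :=
    (continuous_id.mul hfc).aestronglyMeasurable
  rw [memLp_two_iff_integrable_sq hm, integrable_gauss_iff]
  have h1 := integrable_gauss_iff.1 h.integrable_sq
  have h2 := integrable_gauss_iff.1 h'.integrable_sq
  set φ := gaussianPDFReal 0 1 with hφ
  have hφ0 : ∀ x, 0 ≤ φ x := gaussianPDFReal_nonneg 0 1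
  -- The bound is uniform in n: integrating (-x f² φ)' over [-n, n] leaves nonpositive boundary
  -- terms, and the cross term 2 x f f' is absorbed through (x f - 2 f')² ≥ 0, which produces the
  -- constants 2 and 4.
  refine integrable_of_intervalIntegral_norm_bounded
    (l := atTop) (a := fun n : ℕ => -(n : ℝ)) (b := fun n : ℕ => (n : ℝ))
    (2 * (∫ x, φ x * f x ^ 2) + 4 * ∫ x, φ x * f' x ^ 2) (fun n => ?_)
    (tendsto_neg_atTop_atBot.comp tendsto_natCast_atTop_atTop) tendsto_natCast_atTop_atTop
    (Eventually.of_forall fun n => ?_)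
  · exact (Continuous.integrableOn_Icc (by fun_prop)).mono_set Set.Ioc_subset_Icc_self
  · have hle : -(n : ℝ) ≤ n := by linarith [(Nat.cast_nonneg n : (0 : ℝ) ≤ n)]
    have hG : ∀ x, HasDerivAt (fun x => -(x * f x ^ 2 * φ x))
        (φ x * ((x * f x) ^ 2 - f x ^ 2 - 2 * x * f x * f' x)) x := fun x => by
      have := (((hasDerivAt_id x).mul ((hd x).pow 2)).mul (hasDerivAt_gaussianPDFReal x)).neg
      refine this.congr_deriv ?_
      simp
      ring
    have hI := intervalIntegral.integral_eq_sub_of_hasDerivAt (a := -(n : ℝ)) (b := n)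
      (fun x _ => hG x) (Continuous.intervalIntegrable (by fun_prop) _ _)
    have hb1 : ∫ x in (-(n : ℝ))..n, φ x * f x ^ 2 ≤ ∫ x, φ x * f x ^ 2 := by
      rw [intervalIntegral.integral_of_le hle]
      exact setIntegral_le_integral h1 (ae_of_all _ fun x => mul_nonneg (hφ0 x) (sq_nonneg _))
    have hb2 : ∫ x in (-(n : ℝ))..n, φ x * f' x ^ 2 ≤ ∫ x, φ x * f' x ^ 2 := by
      rw [intervalIntegral.integral_of_le hle]
      exact setIntegral_le_integral h2 (ae_of_all _ fun x => mul_nonneg (hφ0 x) (sq_nonneg _))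
    have hmono : ∫ x in (-(n : ℝ))..n, ‖φ x * (x * f x) ^ 2‖ ≤
        ∫ x in (-(n : ℝ))..n, (2 * (φ x * ((x * f x) ^ 2 - f x ^ 2 - 2 * x * f x * f' x)) +
          2 * (φ x * f x ^ 2) + 4 * (φ x * f' x ^ 2)) := by
      refine intervalIntegral.integral_mono_on hle (Continuous.intervalIntegrable (by fun_prop) _ _)
        (Continuous.intervalIntegrable (by fun_prop) _ _) fun x _ => ?_
      rw [Real.norm_of_nonneg (mul_nonneg (hφ0 x) (sq_nonneg _))]
      nlinarith [mul_nonneg (hφ0 x) (sq_nonneg (x * f x - 2 * f' x))]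
    rw [intervalIntegral.integral_add, intervalIntegral.integral_add,
      intervalIntegral.integral_const_mul, intervalIntegral.integral_const_mul,
      intervalIntegral.integral_const_mul, hI] at hmono
    · have e1 : 0 ≤ (n : ℝ) * f n ^ 2 * φ n :=
        mul_nonneg (mul_nonneg n.cast_nonneg (sq_nonneg _)) (hφ0 _)
      have e2 : 0 ≤ (n : ℝ) * f (-n) ^ 2 * φ (-n) :=
        mul_nonneg (mul_nonneg n.cast_nonneg (sq_nonneg _)) (hφ0 _)
      linarith
    all_goals exact Continuous.intervalIntegrable (by fun_prop) _ _

/-- Smooth functions all of whose derivatives are square integrable for the Gaussian measure. -/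
structure SmoothL2 (f : ℝ → ℝ) : Prop where
  smooth : ContDiff ℝ ((⊤ : ℕ∞) : WithTop ℕ∞) f
  memLp : ∀ n, MemLp (deriv^[n] f) 2 gauss

namespace SmoothL2

variable {f g : ℝ → ℝ}

theorem memLp_self (hf : SmoothL2 f) : MemLp f 2 gauss := hf.memLp 0

theorem derivative (hf : SmoothL2 f) : SmoothL2 (deriv f) :=
  ⟨(contDiff_infty_iff_deriv.1 hf.smooth).2, fun n => hf.memLp (n + 1)⟩

theorem iterate (hf : SmoothL2 f) (n : ℕ) : SmoothL2 (deriv^[n] f) := by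
  induction n with
  | zero => exact hf
  | succ n ih => rw [Function.iterate_succ_apply']; exact ih.derivative

theorem hasDerivAt (hf : SmoothL2 f) (x : ℝ) : HasDerivAt f (deriv f x) x :=
  ((contDiff_infty_iff_deriv.1 hf.smooth).1 x).hasDerivAt

theorem continuous (hf : SmoothL2 f) : Continuous f := hf.smooth.continuous

theorem memLp_id_mul (hf : SmoothL2 f) : MemLp (fun x => x * f x) 2 gauss :=
  BackwardTaylor.memLp_id_mul hf.hasDerivAt hf.derivative.continuous hf.memLp_self hf.derivative.memLp_self

theorem integrable_mul (hf : SmoothL2 f) (hg : SmoothL2 g) :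
    Integrable (fun x => f x * g x) gauss :=
  hf.memLp_self.integrable_mul hg.memLp_self

end SmoothL2

/-! ### The Gaussian divergence and its commutation with the derivative. -/

/-- The adjoint of the derivative in the Gaussian `L²` space. -/
def gaussDiv (f : ℝ → ℝ) : ℝ → ℝ := fun x => x * f x - deriv f x

/-- The canonical commutation relation Dδ = δD + 1; all later norm computations rest on it. -/
theorem deriv_gaussDiv {f : ℝ → ℝ} (hf : SmoothL2 f) :
    deriv (gaussDiv f) = fun x => f x + gaussDiv (deriv f) x := by
  funext x
  have := (((hasDerivAt_id x).mul (hf.hasDerivAt x)).sub (hf.derivative.hasDerivAt x))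
  refine (HasDerivAt.deriv (f := gaussDiv f) ?_)
  refine this.congr_deriv ?_
  simp [gaussDiv]
  ring

theorem iterate_deriv_add {f g : ℝ → ℝ} (hf : ContDiff ℝ ((⊤ : ℕ∞) : WithTop ℕ∞) f)
    (hg : ContDiff ℝ ((⊤ : ℕ∞) : WithTop ℕ∞) g) (n : ℕ) :
    deriv^[n] (fun x => f x + g x) = fun x => deriv^[n] f x + deriv^[n] g x := by
  induction n generalizing f g with
  | zero => rfl
  | succ n ih =>
    have h : deriv (fun x => f x + g x) = fun x => deriv f x + deriv g x := by
      funext x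
      exact deriv_fun_add ((contDiff_infty_iff_deriv.1 hf).1 x)
        ((contDiff_infty_iff_deriv.1 hg).1 x)
    simp only [Function.iterate_succ_apply, h]
    exact ih (contDiff_infty_iff_deriv.1 hf).2 (contDiff_infty_iff_deriv.1 hg).2

theorem contDiff_gaussDiv {f : ℝ → ℝ} (hf : ContDiff ℝ ((⊤ : ℕ∞) : WithTop ℕ∞) f) :
    ContDiff ℝ ((⊤ : ℕ∞) : WithTop ℕ∞) (gaussDiv f) :=
  (contDiff_id.mul hf).sub (contDiff_infty_iff_deriv.1 hf).2

namespace SmoothL2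

variable {f g : ℝ → ℝ}

theorem add (hf : SmoothL2 f) (hg : SmoothL2 g) : SmoothL2 (fun x => f x + g x) :=
  ⟨hf.smooth.add hg.smooth, fun n => by
    rw [iterate_deriv_add hf.smooth hg.smooth]; exact (hf.memLp n).add (hg.memLp n)⟩

theorem const_mul (hf : SmoothL2 f) (c : ℝ) : SmoothL2 (fun x => c * f x) := by
  refine ⟨contDiff_const.mul hf.smooth, fun n => ?_⟩
  have : deriv^[n] (fun x => c * f x) = fun x => c * deriv^[n] f x := by
    induction n generalizing f with
    | zero => rfl
    | succ n ih =>
      have h : deriv (fun x => c * f x) = fun x => c * deriv f x := by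
        funext x
        exact deriv_const_mul c (hf.hasDerivAt x).differentiableAt
      simp only [Function.iterate_succ_apply, h]
      exact ih hf.derivative
  rw [this]
  exact (hf.memLp n).const_mul c

theorem const (c : ℝ) : SmoothL2 (fun _ => c) := by
  refine ⟨contDiff_const, fun n => ?_⟩
  rcases n with _ | n
  · exact memLp_const c
  · have : deriv^[n + 1] (fun _ : ℝ => c) = fun _ => (0 : ℝ) := by
      induction n with
      | zero => funext x; simp
      | succ n ih => rw [Function.iterate_succ_apply', ih]; funext x; simp
    rw [this]
    exact memLp_const 0

theorem sum {ι : Type*} {s : Finset ι} {F : ι → ℝ → ℝ} (h : ∀ i ∈ s, SmoothL2 (F i)) :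
    SmoothL2 (fun x => ∑ i ∈ s, F i x) := by
  classical
  induction s using Finset.induction_on with
  | empty => simpa using const 0
  | insert a s ha ih =>
    simp only [Finset.sum_insert ha]
    exact (h a (Finset.mem_insert_self a s)).add
      (ih fun i hi => h i (Finset.mem_insert_of_mem hi))

/-- Square integrability of x f needs f' in L² as well, so stability under δ holds only because all
derivatives are controlled; commutation reduces the n-th derivative of δf to δ of higher
derivatives. -/
theorem div (hf : SmoothL2 f) : SmoothL2 (gaussDiv f) := by
  refine ⟨contDiff_gaussDiv hf.smooth, fun n => ?_⟩
  induction n generalizing f with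
  | zero => exact hf.memLp_id_mul.sub hf.derivative.memLp_self
  | succ n ih =>
    rw [Function.iterate_succ_apply, deriv_gaussDiv hf,
      iterate_deriv_add hf.smooth (contDiff_gaussDiv hf.derivative.smooth)]
    exact (hf.memLp n).add (ih hf.derivative)

theorem div_iterate (hf : SmoothL2 f) (n : ℕ) : SmoothL2 (gaussDiv^[n] f) := by
  induction n with
  | zero => exact hf
  | succ n ih => rw [Function.iterate_succ_apply']; exact ih.div

/-- Gaussian integration by parts. -/
theorem integral_deriv_mul (hf : SmoothL2 f) (hg : SmoothL2 g) :
    ∫ x, deriv f x * g x ∂gauss = ∫ x, f x * gaussDiv g x ∂gauss := by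
  rw [← sub_eq_zero, ← integral_sub (hf.derivative.integrable_mul hg) (hf.integrable_mul hg.div),
    integral_gauss_eq]
  refine integral_eq_zero_of_hasDerivAt_of_integrable
    (f := fun x => gaussianPDFReal 0 1 x * (f x * g x)) (fun x => ?_)
    (integrable_gauss_iff.1 ((hf.derivative.integrable_mul hg).sub (hf.integrable_mul hg.div)))
    (integrable_gauss_iff.1 (hf.integrable_mul hg))
  have := (hasDerivAt_gaussianPDFReal x).mul ((hf.hasDerivAt x).mul (hg.hasDerivAt x))
  refine this.congr_deriv ?_
  simp [gaussDiv]
  ring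

end SmoothL2

theorem gaussDiv_add {f g : ℝ → ℝ} (hf : SmoothL2 f) (hg : SmoothL2 g) :
    gaussDiv (fun x => f x + g x) = fun x => gaussDiv f x + gaussDiv g x := by
  funext x
  simp only [gaussDiv, ((hf.hasDerivAt x).fun_add (hg.hasDerivAt x)).deriv]
  ring

theorem gaussDiv_const_mul {f : ℝ → ℝ} (hf : SmoothL2 f) (c : ℝ) :
    gaussDiv (fun x => c * f x) = fun x => c * gaussDiv f x := by
  funext x
  simp only [gaussDiv, ((hf.hasDerivAt x).const_mul c).deriv]
  ring

theorem gaussDiv_sum {ι : Type*} {s : Finset ι} {F : ι → ℝ → ℝ} (h : ∀ i ∈ s, SmoothL2 (F i)) :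
    gaussDiv (fun x => ∑ i ∈ s, F i x) = fun x => ∑ i ∈ s, gaussDiv (F i) x := by
  funext x
  simp only [gaussDiv, Finset.sum_sub_distrib, Finset.mul_sum,
    (HasDerivAt.fun_sum fun i hi => (h i hi).hasDerivAt x).deriv]

/-- Iterated commutator [D, δ^i] = i δ^{i-1}. The truncated i - 1 is harmless at i = 0, where the
factor i vanishes. -/
theorem deriv_gaussDiv_iterate {f : ℝ → ℝ} (hf : SmoothL2 f) (i : ℕ) :
    deriv (gaussDiv^[i] f) = fun x => gaussDiv^[i] (deriv f) x + i * gaussDiv^[i - 1] f x := by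
  induction i with
  | zero => simp
  | succ i ih =>
    funext x
    rw [Function.iterate_succ_apply', deriv_gaussDiv (hf.div_iterate i), ih,
      gaussDiv_add (hf.derivative.div_iterate i) ((hf.div_iterate (i - 1)).const_mul i),
      gaussDiv_const_mul (hf.div_iterate (i - 1)), Function.iterate_succ_apply']
    rcases i with _ | i
    · simp; ring
    · simp only [Nat.add_sub_cancel, ← Function.iterate_succ_apply' gaussDiv]
      push_cast
      ring

namespace SmoothL2

variable {u v : ℝ → ℝ}

theorem integral_mul_gaussDiv_iterate (hu : SmoothL2 u) (hv : SmoothL2 v) (i : ℕ) :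
    ∫ x, u x * gaussDiv^[i] v x ∂gauss = ∫ x, deriv^[i] u x * v x ∂gauss := by
  induction i generalizing u with
  | zero => rfl
  | succ i ih =>
    rw [Function.iterate_succ_apply', ← integral_deriv_mul hu (hv.div_iterate i),
      ih hu.derivative, Function.iterate_succ_apply]

/-- The inner product of iterated divergences. -/
theorem integral_gaussDiv_iterate_mul (hu : SmoothL2 u) (hv : SmoothL2 v) (n i : ℕ) :
    ∫ x, gaussDiv^[n] u x * gaussDiv^[i] v x ∂gauss =
      ∑ p ∈ Finset.range (n + 1), ((n.choose p * i.choose p * p.factorial : ℕ) : ℝ) *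
        ∫ x, deriv^[i - p] u x * deriv^[n - p] v x ∂gauss := by
  induction n generalizing i v with
  | zero => simpa using integral_mul_gaussDiv_iterate hu hv i
  | succ n ih =>
    -- Integration by parts moves one δ across as a D, which is then commuted through δ^i.
    have h1 : ∫ x, gaussDiv^[n + 1] u x * gaussDiv^[i] v x ∂gauss =
        ∫ x, gaussDiv^[n] u x * gaussDiv^[i] (deriv v) x ∂gauss +
          i * ∫ x, gaussDiv^[n] u x * gaussDiv^[i - 1] v x ∂gauss := by
      simp_rw [mul_comm (gaussDiv^[n + 1] u _), Function.iterate_succ_apply' gaussDiv n u]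
      rw [← integral_deriv_mul (hv.div_iterate i) (hu.div_iterate n),
        deriv_gaussDiv_iterate hv, ← integral_const_mul, ← integral_add]
      · congr 1; funext x; ring
      · exact (hu.div_iterate n).integrable_mul (hv.derivative.div_iterate i)
      · exact ((hu.div_iterate n).integrable_mul (hv.div_iterate (i - 1))).const_mul _
    rw [h1, ih hv.derivative, ih hv, Finset.sum_range_succ' _ (n + 1)]
    -- Pascal's rule in n + 1, together with i C(i-1,p) p! = C(i,p+1) (p+1)!, matches the two
    -- families given by the induction hypothesis.
    have h2 : ∀ p ∈ Finset.range (n + 1),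
        (((n + 1).choose (p + 1) * i.choose (p + 1) * (p + 1).factorial : ℕ) : ℝ) *
          ∫ x, deriv^[i - (p + 1)] u x * deriv^[n + 1 - (p + 1)] v x ∂gauss =
        i * (((n.choose p * (i - 1).choose p * p.factorial : ℕ) : ℝ) *
          ∫ x, deriv^[i - 1 - p] u x * deriv^[n - p] v x ∂gauss) +
        ((n.choose (p + 1) * i.choose (p + 1) * (p + 1).factorial : ℕ) : ℝ) *
          ∫ x, deriv^[i - (p + 1)] u x *
            deriv^[n - (p + 1)] (deriv v) x ∂gauss := by
      intro p hp
      have hpn : p ≤ n := Nat.lt_succ_iff.1 (Finset.mem_range.1 hp)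
      have e1 : i - 1 - p = i - (p + 1) := by omega
      have e2 : i * (n.choose p * (i - 1).choose p * p.factorial) =
          n.choose p * i.choose (p + 1) * (p + 1).factorial := by
        rcases i with _ | i
        · simp
        · have := Nat.add_one_mul_choose_eq i p
          simp only [Nat.add_sub_cancel, Nat.factorial_succ]
          linear_combination (n.choose p * p.factorial) * this
      have e2' : (i : ℝ) * ((n.choose p * (i - 1).choose p * p.factorial : ℕ) : ℝ) =
          ((n.choose p * i.choose (p + 1) * (p + 1).factorial : ℕ) : ℝ) := by
        exact_mod_cast e2
      rw [e1, ← mul_assoc, e2', Nat.add_sub_add_right, Nat.choose_succ_succ]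
      rcases hpn.lt_or_eq with h | h
      · have e3 : deriv^[n - (p + 1)] (deriv v) = deriv^[n - p] v := by
          rw [← Function.iterate_succ_apply]; congr 1; omega
        rw [e3]
        push_cast
        ring
      · subst h
        simp
    rw [Finset.sum_congr rfl h2, Finset.sum_add_distrib, ← Finset.mul_sum]
    have h3 := Finset.sum_range_succ' (fun p =>
      ((n.choose p * i.choose p * p.factorial : ℕ) : ℝ) *
        ∫ x, deriv^[i - p] u x * deriv^[n - p] (deriv v) x ∂gauss) (n + 1)
    rw [Finset.sum_range_succ] at h3
    simp only [Nat.choose_succ_self, zero_mul, Nat.cast_zero, add_zero] at h3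
    rw [h3]
    simp only [Nat.choose_zero_right, Nat.sub_zero, ← Function.iterate_succ_apply]
    ring

/-- The diagonal case of the inner product formula, reindexed by d = i - p, the number of
derivatives left on u. -/
theorem integral_gaussDiv_iterate_sq (hu : SmoothL2 u) (i : ℕ) :
    ∫ x, (gaussDiv^[i] u x) ^ 2 ∂gauss =
      ∑ d ∈ Finset.range (i + 1), (i.choose d : ℝ) ^ 2 * (i - d).factorial *
        ∫ x, (deriv^[d] u x) ^ 2 ∂gauss := by
  simp_rw [pow_two (gaussDiv^[i] u _), integral_gaussDiv_iterate_mul hu hu i i]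
  rw [← Finset.sum_range_reflect]
  refine Finset.sum_congr rfl fun d hd => ?_
  have hd' : d ≤ i := Nat.lt_succ_iff.1 (Finset.mem_range.1 hd)
  have e : i - (i - d) = d := by omega
  rw [Nat.add_sub_cancel, e, Nat.choose_symm hd']
  push_cast
  simp_rw [pow_two]

end SmoothL2

/-! ### Hermite multiplication in normal order. -/

/-- The Hermite polynomials as functions. -/
def herm (k : ℕ) (x : ℝ) : ℝ := Polynomial.aeval x (Polynomial.hermite k)

theorem herm_zero (x : ℝ) : herm 0 x = 1 := by simp [herm]

theorem hasDerivAt_herm (k : ℕ) (x : ℝ) :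
    HasDerivAt (herm k) (x * herm k x - herm (k + 1) x) x := by
  have := Polynomial.hasDerivAt_aeval (Polynomial.hermite k) x
  refine this.congr_deriv ?_
  simp [herm, Polynomial.hermite_succ]

/-- Multiplication by a Hermite polynomial in normally ordered form. -/
theorem herm_mul {u : ℝ → ℝ} (hu : SmoothL2 u) (k : ℕ) :
    (fun x => herm k x * u x) = fun x => ∑ i ∈ Finset.range (k + 1),
      (k.choose i : ℝ) * gaussDiv^[i] (deriv^[k - i] u) x := by
  induction k generalizing u with
  | zero => funext x; simp [herm_zero]
  | succ k ih =>
    -- From h_{k+1} = x h_k - h_k' follows h_{k+1} u = δ(h_k u) + h_k u'; the rest is Pascal's rule.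
    have h1 : (fun x => herm (k + 1) x * u x) =
        fun x => gaussDiv (fun x => herm k x * u x) x + herm k x * deriv u x := by
      funext x
      simp only [gaussDiv, ((hasDerivAt_herm k x).fun_mul (hu.hasDerivAt x)).deriv]
      ring
    have h2 := congrFun (ih hu.derivative)
    funext x
    rw [congrFun h1 x, h2, ih hu, gaussDiv_sum fun i _ =>
      ((hu.iterate (k - i)).div_iterate i).const_mul _, Finset.sum_range_succ' _ (k + 1)]
    have h3 : ∀ i ∈ Finset.range (k + 1),
        ((k + 1).choose (i + 1) : ℝ) * gaussDiv^[i + 1] (deriv^[k + 1 - (i + 1)] u) x =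
        gaussDiv (fun x => (k.choose i : ℝ) * gaussDiv^[i] (deriv^[k - i] u) x) x +
          (k.choose (i + 1) : ℝ) * gaussDiv^[i + 1] (deriv^[k - (i + 1)] (deriv u)) x := by
      intro i hi
      have hik : i ≤ k := Nat.lt_succ_iff.1 (Finset.mem_range.1 hi)
      rw [gaussDiv_const_mul ((hu.iterate (k - i)).div_iterate i),
        ← Function.iterate_succ_apply' gaussDiv, Nat.add_sub_add_right, Nat.choose_succ_succ]
      rcases hik.lt_or_eq with h | h
      · have e3 : deriv^[k - (i + 1)] (deriv u) = deriv^[k - i] u := by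
          rw [← Function.iterate_succ_apply]; congr 1; omega
        rw [e3]
        push_cast
        ring
      · subst h
        simp
    rw [Finset.sum_congr rfl h3, Finset.sum_add_distrib]
    have h4 := Finset.sum_range_succ' (fun i =>
      (k.choose i : ℝ) * gaussDiv^[i] (deriv^[k - i] (deriv u)) x) (k + 1)
    rw [Finset.sum_range_succ] at h4
    simp only [Nat.choose_succ_self, Nat.cast_zero, zero_mul, add_zero] at h4
    rw [h4]
    simp only [Nat.choose_zero_right, Nat.cast_one, Nat.sub_zero, Function.iterate_zero, id_eq,
      ← Function.iterate_succ_apply deriv]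
    ring

/-- The polynomials with generating function `exp (t x + t ^ 2 / 2)`. -/
def heatPoly (l : ℕ) (x : ℝ) : ℝ :=
  ∑ j ∈ Finset.range (l / 2 + 1),
    1 / ((j.factorial : ℝ) * ((l - 2 * j).factorial : ℝ)) * herm (l - 2 * j) x

theorem heatPoly_mul {u : ℝ → ℝ} (hu : SmoothL2 u) (l : ℕ) (x : ℝ) :
    heatPoly l x * u x = ∑ j ∈ Finset.range (l / 2 + 1), ∑ i ∈ Finset.range (l - 2 * j + 1),
      1 / ((j.factorial : ℝ) * i.factorial * (l - 2 * j - i).factorial) *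
        gaussDiv^[i] (deriv^[l - 2 * j - i] u) x := by
  rw [heatPoly, Finset.sum_mul]
  refine Finset.sum_congr rfl fun j _ => ?_
  rw [mul_assoc, congrFun (herm_mul hu (l - 2 * j)) x, Finset.mul_sum]
  refine Finset.sum_congr rfl fun i hi => ?_
  have hi' : i ≤ l - 2 * j := Nat.lt_succ_iff.1 (Finset.mem_range.1 hi)
  rw [← mul_assoc, Nat.cast_choose ℝ hi']
  congr 1
  have := Nat.factorial_ne_zero
  field_simp

/-! ### Geometric bound for the terms of the series. -/

theorem pow_div_factorial_mul_le {a b : ℝ} (ha : 0 ≤ a) (hb : 0 ≤ b) (m n : ℕ) :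
    a ^ m / m.factorial * (b ^ n / n.factorial) ≤ (a + b) ^ (m + n) / (m + n).factorial := by
  have h : a ^ m * b ^ n * ((m + n).choose m : ℝ) ≤ (a + b) ^ (m + n) := by
    rw [add_pow]
    have := Finset.single_le_sum (f := fun k => a ^ k * b ^ (m + n - k) * ((m + n).choose k : ℝ))
      (s := Finset.range (m + n + 1)) (fun k _ => by positivity)
      (Finset.mem_range.2 (by omega : m < m + n + 1))
    simpa using this
  rw [Nat.cast_add_choose] at h
  have h1 : (0 : ℝ) < m.factorial := by positivity
  have h2 : (0 : ℝ) < n.factorial := by positivity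
  have h3 : (0 : ℝ) < (m + n).factorial := by positivity
  rw [le_div_iff₀ h3]
  refine le_trans (le_of_eq ?_) h
  field_simp

/-- The quotient is the multinomial coefficient with seven blocks j, j, q, q, d, d, e, hence one
term in the expansion of (1+⋯+1)^n with seven ones. The blocks are added one at a time. -/
theorem multinomial_seven_le (d e j q : ℕ) :
    ((2 * j + 2 * q + 2 * d + e).factorial : ℝ) /
      ((j.factorial * q.factorial * d.factorial) ^ 2 * e.factorial) ≤
      7 ^ (2 * j + 2 * q + 2 * d + e) := by
  have key : ∀ {a : ℝ} {s m : ℕ} {X : ℝ}, 0 ≤ a → 0 ≤ X → X ≤ a ^ s / s.factorial →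
      X * (1 / m.factorial) ≤ (a + 1) ^ (s + m) / (s + m).factorial := by
    intro a s m X ha hX h
    refine le_trans ?_ (pow_div_factorial_mul_le ha zero_le_one s m)
    rw [one_pow]
    gcongr
  have h1 : (1 : ℝ) / j.factorial ≤ 1 ^ j / j.factorial := by simp
  have h2 := key (m := j) (by norm_num) (by positivity) h1
  have h3 := key (m := q) (by norm_num) (by positivity) h2
  have h4 := key (m := q) (by norm_num) (by positivity) h3
  have h5 := key (m := d) (by norm_num) (by positivity) h4
  have h6 := key (m := d) (by norm_num) (by positivity) h5
  have h7 := key (m := e) (by norm_num) (by positivity) h6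
  have e1 : j + j + q + q + d + d + e = 2 * j + 2 * q + 2 * d + e := by ring
  norm_num only at h7
  rw [e1, le_div_iff₀ (by positivity)] at h7
  refine le_trans (le_of_eq ?_) h7
  field_simp

theorem integral_normal_ordered_sq_le {f : ℝ → ℝ} (hf : SmoothL2 f) {ρ K : ℝ} (hρ : 0 ≤ ρ)
    (hρ7 : 7 * ρ ≤ 1) (hK : 0 ≤ K)
    (hb : ∀ n, ∫ x, (deriv^[n] f x) ^ 2 ∂gauss ≤ K * ρ ^ n * n.factorial)
    {l i j q : ℕ} (hl : 2 * j + i + q = l) :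
    ∫ x, (1 / ((j.factorial : ℝ) * i.factorial * q.factorial) *
      gaussDiv^[i] (deriv^[q] (deriv^[l] f)) x) ^ 2 ∂gauss ≤ (l + 1) * (K * (7 * ρ) ^ l) := by
  simp_rw [mul_pow (1 / _ : ℝ), integral_const_mul]
  rw [((hf.iterate l).iterate q).integral_gaussDiv_iterate_sq, Finset.mul_sum]
  have h : ∀ d ∈ Finset.range (i + 1),
      (1 / ((j.factorial : ℝ) * i.factorial * q.factorial)) ^ 2 *
        ((i.choose d : ℝ) ^ 2 * (i - d).factorial *
          ∫ x, (deriv^[d] (deriv^[q] (deriv^[l] f)) x) ^ 2 ∂gauss) ≤ K * (7 * ρ) ^ l := by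
    intro d hd
    have hdi : d ≤ i := Nat.lt_succ_iff.1 (Finset.mem_range.1 hd)
    obtain ⟨e, rfl⟩ := Nat.exists_eq_add_of_le hdi
    -- With l = 2j + i + q and i = d + e, the order d + q + l of differentiation is exactly the
    -- total size of the seven blocks. After the factorials of i cancel, the coefficient times this
    -- order's factorial is the multinomial coefficient. As the order is at least l and 7ρ ≤ 1, its
    -- power of 7ρ is at most (7ρ)^l.
    have hn : d + (q + l) = 2 * j + 2 * q + 2 * d + e := by omega
    rw [← Function.iterate_add_apply, ← Function.iterate_add_apply, Nat.add_sub_cancel_left,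
      Nat.cast_add_choose]
    calc _ ≤ (1 / ((j.factorial : ℝ) * (d + e).factorial * q.factorial)) ^ 2 *
        ((((d + e).factorial : ℝ) / (d.factorial * e.factorial)) ^ 2 * e.factorial *
          (K * ρ ^ (d + (q + l)) * (d + (q + l)).factorial)) := by
          gcongr
          rw [← add_assoc]
          exact hb (d + q + l)
      _ = K * ρ ^ (2 * j + 2 * q + 2 * d + e) *
          (((2 * j + 2 * q + 2 * d + e).factorial : ℝ) /
            ((j.factorial * q.factorial * d.factorial) ^ 2 * e.factorial)) := by
          rw [hn]
          field_simp
      _ ≤ K * ρ ^ (2 * j + 2 * q + 2 * d + e) * 7 ^ (2 * j + 2 * q + 2 * d + e) := by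
          gcongr
          exact multinomial_seven_le d e j q
      _ = K * (7 * ρ) ^ (2 * j + 2 * q + 2 * d + e) := by rw [mul_pow]; ring
      _ ≤ K * (7 * ρ) ^ l :=
          mul_le_mul_of_nonneg_left
            (pow_le_pow_of_le_one (by positivity) hρ7 (by omega)) hK
  refine (Finset.sum_le_card_nsmul _ _ _ h).trans ?_
  rw [Finset.card_range, nsmul_eq_mul]
  gcongr
  push_cast
  gcongr
  omega

theorem SmoothL2.heatPoly_mul {u : ℝ → ℝ} (hu : SmoothL2 u) (l : ℕ) :
    SmoothL2 (fun x => heatPoly l x * u x) := by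
  have : (fun x => heatPoly l x * u x) = _ := funext (BackwardTaylor.heatPoly_mul hu l)
  rw [this]
  exact SmoothL2.sum fun j _ => SmoothL2.sum fun i _ =>
    ((hu.iterate _).div_iterate i).const_mul _

/-- The normally ordered expansion has at most (l+1)² terms, so Cauchy–Schwarz costs (l+1)^4 against
the largest squared norm, which itself carries a factor l + 1. -/
theorem integral_heatPoly_mul_sq_le {f : ℝ → ℝ} (hf : SmoothL2 f) {ρ K : ℝ} (hρ : 0 ≤ ρ)
    (hρ7 : 7 * ρ ≤ 1) (hK : 0 ≤ K)
    (hb : ∀ n, ∫ x, (deriv^[n] f x) ^ 2 ∂gauss ≤ K * ρ ^ n * n.factorial) (l : ℕ) :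
    ∫ x, (heatPoly l x * deriv^[l] f x) ^ 2 ∂gauss ≤ ((l : ℝ) + 1) ^ 5 * (K * (7 * ρ) ^ l) := by
  set s := (Finset.range (l / 2 + 1)).sigma fun j => Finset.range (l - 2 * j + 1) with hs
  have hcard : (s.card : ℝ) ≤ ((l : ℝ) + 1) ^ 2 := by
    have : s.card ≤ (l + 1) * (l + 1) := by
      rw [hs, Finset.card_sigma]
      refine (Finset.sum_le_card_nsmul _ _ (l + 1) fun j _ => ?_).trans ?_
      · rw [Finset.card_range]; omega
      · rw [Finset.card_range, smul_eq_mul]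
        exact Nat.mul_le_mul_right _ (by omega)
    rw [pow_two]
    exact_mod_cast this
  set G : (Σ _ : ℕ, ℕ) → ℝ → ℝ := fun a x =>
    1 / ((a.1.factorial : ℝ) * a.2.factorial * (l - 2 * a.1 - a.2).factorial) *
        gaussDiv^[a.2] (deriv^[l - 2 * a.1 - a.2] (deriv^[l] f)) x with hG
  have hsum : ∀ x, heatPoly l x * deriv^[l] f x = ∑ a ∈ s, G a x := fun x => by
    rw [heatPoly_mul (hf.iterate l), hs, Finset.sum_sigma]
  have hGs : ∀ a, SmoothL2 (G a) := fun a =>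
    (((hf.iterate l).iterate _).div_iterate _).const_mul _
  have hint : ∀ a ∈ s, Integrable (fun x => G a x ^ 2) gauss := fun a _ =>
    (hGs a).memLp_self.integrable_sq
  calc ∫ x, (heatPoly l x * deriv^[l] f x) ^ 2 ∂gauss
      ≤ ∫ x, (s.card : ℝ) * ∑ a ∈ s, G a x ^ 2 ∂gauss := by
        refine integral_mono ((hf.iterate l).heatPoly_mul l).memLp_self.integrable_sq
          ((integrable_finsetSum s hint).const_mul _) fun x => ?_
        simp only [hsum]
        exact sq_sum_le_card_mul_sum_sq
    _ = s.card * ∑ a ∈ s, ∫ x, G a x ^ 2 ∂gauss := by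
        rw [integral_const_mul, integral_finsetSum s hint]
    _ ≤ s.card * (s.card * ((l + 1) * (K * (7 * ρ) ^ l))) := by
        gcongr
        rw [← nsmul_eq_mul]
        refine Finset.sum_le_card_nsmul _ _ _ fun a ha => ?_
        rw [hs, Finset.mem_sigma, Finset.mem_range, Finset.mem_range] at ha
        exact integral_normal_ordered_sq_le hf hρ hρ7 hK hb (by omega)
    _ ≤ ((l : ℝ) + 1) ^ 2 * (((l : ℝ) + 1) ^ 2 * ((l + 1) * (K * (7 * ρ) ^ l))) := by
        gcongr
    _ = _ := by ring

/-! ### Telescoping derivatives of the partial sums. -/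

theorem derivative_hermite_succ (n : ℕ) :
    Polynomial.derivative (Polynomial.hermite (n + 1)) = (n + 1) * Polynomial.hermite n := by
  induction n with
  | zero => simp
  | succ n ih =>
    rw [Polynomial.hermite_succ (n + 1), ih]
    simp only [Polynomial.derivative_sub, Polynomial.derivative_mul, Polynomial.derivative_X,
      Polynomial.derivative_add, Polynomial.derivative_natCast, Polynomial.derivative_one, ih]
    have := Polynomial.hermite_succ n
    push_cast
    linear_combination (-(n : Polynomial ℤ) - 1) * this

theorem hasDerivAt_herm_succ (k : ℕ) (x : ℝ) :
    HasDerivAt (herm (k + 1)) ((k + 1) * herm k x) x := by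
  have := Polynomial.hasDerivAt_aeval (Polynomial.hermite (k + 1)) x
  refine this.congr_deriv ?_
  rw [derivative_hermite_succ]
  simp [herm]

theorem heatPoly_zero (x : ℝ) : heatPoly 0 x = 1 := by simp [heatPoly, herm_zero]

/-- The Appell property, visible on the generating function exp(tx + t²/2). When l + 1 is even the
last summand is constant, so the range of summation shrinks; the auxiliary `c` pads with zero there.
-/
theorem hasDerivAt_heatPoly_succ (l : ℕ) (x : ℝ) :
    HasDerivAt (heatPoly (l + 1)) (heatPoly l x) x := by
  set c : ℕ → ℝ := fun j => if 2 * j ≤ l then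
    1 / ((j.factorial : ℝ) * ((l - 2 * j).factorial : ℝ)) * herm (l - 2 * j) x else 0 with hc
  have h : HasDerivAt (heatPoly (l + 1)) (∑ j ∈ Finset.range ((l + 1) / 2 + 1), c j) x := by
    refine HasDerivAt.fun_sum fun j hj => ?_
    have hj' : j < (l + 1) / 2 + 1 := Finset.mem_range.1 hj
    rcases le_or_gt (2 * j) l with h | h
    · obtain ⟨k, rfl⟩ := Nat.exists_eq_add_of_le h
      have e : 2 * j + k + 1 - 2 * j = k + 1 := by omega
      simp only [hc, e, if_pos h, Nat.add_sub_cancel_left]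
      refine ((hasDerivAt_herm_succ k x).const_mul _).congr_deriv ?_
      rw [Nat.factorial_succ]
      push_cast
      field_simp
    · have e : l + 1 - 2 * j = 0 := by omega
      simp only [hc, e, if_neg h.not_ge, herm_zero]
      exact hasDerivAt_const x _
  refine h.congr_deriv ?_
  rw [heatPoly]
  have h2 : ∀ j ∈ Finset.range (l / 2 + 1), c j =
      1 / ((j.factorial : ℝ) * ((l - 2 * j).factorial : ℝ)) * herm (l - 2 * j) x := fun j hj =>
    if_pos (by have := Finset.mem_range.1 hj; omega)
  rw [← Finset.sum_congr rfl h2]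
  symm
  refine Finset.sum_subset (Finset.range_subset_range.2 (by omega)) fun j _ hj => if_neg ?_
  rw [Finset.mem_range] at hj
  omega

/-- Partial sums of the backward Taylor series of `f` at the points of the line. -/
def backSum (f : ℝ → ℝ) (N : ℕ) (x : ℝ) : ℝ :=
  ∑ l ∈ Finset.range N, (-1) ^ l * (heatPoly l x * deriv^[l] f x)

theorem SmoothL2.backSum {f : ℝ → ℝ} (hf : SmoothL2 f) (N : ℕ) :
    SmoothL2 (BackwardTaylor.backSum f N) :=
  SmoothL2.sum fun l _ => ((hf.iterate l).heatPoly_mul l).const_mul _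

/-- By the product rule each term contributes two pieces, one of which cancels a piece of its
neighbour; only the last top-order piece survives. -/
theorem hasDerivAt_backSum {f : ℝ → ℝ} (hf : SmoothL2 f) (N : ℕ) (x : ℝ) :
    HasDerivAt (backSum f (N + 1)) ((-1) ^ N * (heatPoly N x * deriv^[N + 1] f x)) x := by
  induction N with
  | zero =>
    have : backSum f (0 + 1) = f := by funext y; simp [backSum, heatPoly_zero]
    rw [this]
    exact (hf.hasDerivAt x).congr_deriv (by simp [heatPoly_zero])
  | succ N ih =>
    have e : backSum f (N + 1 + 1) = fun y => backSum f (N + 1) y +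
        (-1) ^ (N + 1) * (heatPoly (N + 1) y * deriv^[N + 1] f y) := by
      funext y; rw [backSum, Finset.sum_range_succ]; rfl
    rw [e]
    refine (ih.add (((hasDerivAt_heatPoly_succ N x).mul
      ((hf.iterate (N + 1)).hasDerivAt x)).const_mul _)).congr_deriv ?_
    rw [← Function.iterate_succ_apply' deriv (N + 1) f]
    ring

theorem exists_poly_mul_pow_le (k : ℕ) {r a : ℝ} (hr : 0 ≤ r) (hra : r < a) :
    ∃ C : ℝ, 0 < C ∧ ∀ n : ℕ, ((n : ℝ) + 1) ^ k * r ^ n ≤ C * a ^ n := by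
  have ha : 0 < a := hr.trans_lt hra
  have h1 : r / a < 1 := (div_lt_one ha).2 hra
  have h := tendsto_pow_const_mul_const_pow_of_abs_lt_one k
    (abs_lt.2 ⟨by linarith [div_nonneg hr ha.le], h1⟩)
  have h' := (h.const_mul ((2 : ℝ) ^ k)).bddAbove_range
  obtain ⟨C, hC⟩ := h'
  refine ⟨max C 1, by positivity, fun n => ?_⟩
  have hle : ((n : ℝ) + 1) ^ k * (r / a) ^ n ≤ max C 1 := by
    rcases Nat.eq_zero_or_pos n with rfl | hn
    · simp
    · refine le_trans ?_ ((hC ⟨n, rfl⟩).trans (le_max_left _ _))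
      have : (1 : ℝ) ≤ n := by exact_mod_cast hn
      simp only
      rw [← mul_assoc, ← mul_pow]
      gcongr
      linarith
  rw [div_pow, mul_div_assoc', div_le_iff₀ (by positivity)] at hle
  exact hle

/-! ### The means of the partial sums. -/

/-- The finite sets {c j + q < N} exhaust ℕ × ℕ, so every such grading sums an unconditionally
convergent series to the same value. The grading c = 2 is that of `backSum`; c = 1 is the one in
which the sum can be evaluated. -/
theorem tendsto_sum_weighted {t : ℕ × ℕ → ℝ} {T : ℝ} (ht : HasSum t T) {c : ℕ} (hc : 1 ≤ c) :
    Tendsto (fun N => ∑ l ∈ Finset.range N, ∑ j ∈ Finset.range (l / c + 1), t (j, l - c * j))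
      atTop (𝓝 T) := by
  set U : ℕ → Finset (ℕ × ℕ) := fun N =>
    (Finset.range N ×ˢ Finset.range N).filter fun p => c * p.1 + p.2 < N with hU
  have hmem : ∀ N p, p ∈ U N ↔ c * p.1 + p.2 < N := fun N p => by
    simp only [hU, Finset.mem_filter, Finset.mem_product, Finset.mem_range]
    refine ⟨fun h => h.2, fun h => ⟨⟨?_, by omega⟩, h⟩⟩
    nlinarith
  have hlim : Tendsto U atTop atTop := by
    refine tendsto_atTop_finset_of_monotone (fun N N' h p hp => ?_) fun p => ?_
    · rw [hmem] at hp ⊢; omega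
    · exact ⟨c * p.1 + p.2 + 1, (hmem _ _).2 (by omega)⟩
  refine (ht.comp hlim).congr fun N => ?_
  rw [Function.comp_apply, Finset.sum_sigma']
  refine Finset.sum_nbij' (fun p => ⟨c * p.1 + p.2, p.1⟩) (fun a => (a.2, a.1 - c * a.2))
    (fun p hp => ?_) (fun a ha => ?_) (fun p _ => ?_) (fun a ha => ?_) (fun p _ => ?_)
  · rw [hmem] at hp
    simp only [Finset.mem_sigma, Finset.mem_range]
    refine ⟨hp, ?_⟩
    rw [Nat.lt_succ_iff, Nat.le_div_iff_mul_le hc]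
    nlinarith
  · simp only [Finset.mem_sigma, Finset.mem_range, Nat.lt_succ_iff,
      Nat.le_div_iff_mul_le (show 0 < c from hc)] at ha
    rw [hmem]
    have := mul_comm a.2 c
    simp only
    omega
  · simp
  · simp only [Finset.mem_sigma, Finset.mem_range, Nat.lt_succ_iff,
      Nat.le_div_iff_mul_le (show 0 < c from hc)] at ha
    have := mul_comm a.2 c
    obtain ⟨a1, a2⟩ := a
    simp only [Sigma.mk.injEq, heq_eq_eq, and_true] at *
    omega
  · simp

/-- In effect h_k = δ^k 1, so h_k moves onto u as k derivatives. -/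
theorem integral_herm_mul {u : ℝ → ℝ} (hu : SmoothL2 u) (k : ℕ) :
    ∫ x, herm k x * u x ∂gauss = ∫ x, deriv^[k] u x ∂gauss := by
  induction k generalizing u with
  | zero => simp [herm_zero]
  | succ k ih =>
    have hs : ∀ {v : ℝ → ℝ}, SmoothL2 v → SmoothL2 (fun x => herm k x * v x) := fun hv => by
      rw [herm_mul hv k]
      exact SmoothL2.sum fun i _ => ((hv.iterate _).div_iterate i).const_mul _
    have h1 : ∀ x, herm (k + 1) x * u x =
        1 * gaussDiv (fun x => herm k x * u x) x + herm k x * deriv u x := fun x => by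
      simp only [gaussDiv, ((hasDerivAt_herm k x).fun_mul (hu.hasDerivAt x)).deriv]
      ring
    simp_rw [h1]
    rw [integral_add ((SmoothL2.const 1).integrable_mul (hs hu).div)
      ((hs hu.derivative).memLp_self.integrable one_le_two), ih hu.derivative,
      ← (SmoothL2.const 1).integral_deriv_mul (hs hu)]
    simp

theorem sq_integral_le {f : ℝ → ℝ} (hf : MemLp f 2 gauss) :
    (∫ x, f x ∂gauss) ^ 2 ≤ ∫ x, f x ^ 2 ∂gauss := by
  have h1 := variance_eq_sub hf
  have h2 := variance_nonneg f gauss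
  simp only [Pi.pow_apply] at h1
  linarith

theorem integral_backSum {f : ℝ → ℝ} (hf : SmoothL2 f) (N : ℕ) :
    ∫ x, backSum f N x ∂gauss = ∑ l ∈ Finset.range N, ∑ j ∈ Finset.range (l / 2 + 1),
      (-1) ^ (l - 2 * j) / ((j.factorial : ℝ) * ((l - 2 * j).factorial : ℝ)) *
        ∫ x, deriv^[2 * (j + (l - 2 * j))] f x ∂gauss := by
  simp only [backSum]
  rw [integral_finsetSum _ fun l _ =>
    (((hf.iterate l).heatPoly_mul l).memLp_self.integrable one_le_two).const_mul _]
  refine Finset.sum_congr rfl fun l _ => ?_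
  have hs : ∀ k, Integrable (fun x => herm k x * deriv^[l] f x) gauss := fun k => by
    rw [herm_mul (hf.iterate l) k]
    exact integrable_finsetSum _ fun i _ =>
      ((((hf.iterate l).iterate _).div_iterate i).const_mul _).memLp_self.integrable one_le_two
  simp_rw [heatPoly, Finset.sum_mul, mul_assoc]
  rw [integral_const_mul, integral_finsetSum _ fun j _ => (hs _).const_mul _, Finset.mul_sum]
  refine Finset.sum_congr rfl fun j hj => ?_
  have hj' : j < l / 2 + 1 := Finset.mem_range.1 hj
  obtain ⟨q, rfl⟩ := Nat.exists_eq_add_of_le (show 2 * j ≤ l by omega)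
  rw [integral_const_mul, integral_herm_mul (hf.iterate _), Nat.add_sub_cancel_left,
    ← Function.iterate_add_apply]
  have e : q + (2 * j + q) = 2 * (j + q) := by ring
  rw [e, pow_add, pow_mul]
  simp
  ring

theorem tendsto_integral_backSum {f : ℝ → ℝ} (hf : SmoothL2 f) {ρ K : ℝ} (hρ : 0 ≤ ρ)
    (hρ4 : 4 * ρ < 1) (hK : 0 ≤ K)
    (hb : ∀ n, ∫ x, (deriv^[n] f x) ^ 2 ∂gauss ≤ K * ρ ^ n * n.factorial) :
    Tendsto (fun N => ∫ x, backSum f N x ∂gauss) atTop (𝓝 (∫ x, f x ∂gauss)) := by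
  set e : ℕ → ℝ := fun n => ∫ x, deriv^[n] f x ∂gauss with he
  set t : ℕ × ℕ → ℝ := fun p =>
    (-1) ^ p.2 / ((p.1.factorial : ℝ) * (p.2.factorial : ℝ)) * e (2 * (p.1 + p.2)) with ht
  -- Jensen bounds the squared mean by the second moment, and (2m)! ≤ 4^m (m!)² turns its square
  -- root into m! times a geometric factor.
  have hem : ∀ m, |e (2 * m)| ≤ √K * (2 * ρ) ^ m * m.factorial := fun m => by
    refine abs_le_of_sq_le_sq ?_ (by positivity)
    refine (sq_integral_le (hf.memLp (2 * m))).trans ((hb (2 * m)).trans ?_)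
    have h4 : ((2 * m).factorial : ℝ) ≤ 4 ^ m * (m.factorial : ℝ) ^ 2 := by
      have h1 := Nat.centralBinom_eq_two_mul_choose m
      have h2 := Nat.choose_mul_factorial_mul_factorial (show m ≤ 2 * m by omega)
      have h3 : (2 * m).choose m ≤ 2 ^ (2 * m) := Nat.choose_le_two_pow _ _
      rw [pow_mul] at h3
      have e1 : 2 * m - m = m := by omega
      rw [e1] at h2
      have : (2 * m).factorial ≤ 4 ^ m * m.factorial ^ 2 := by
        rw [← h2, mul_assoc, pow_two]
        exact Nat.mul_le_mul_right _ (by simpa using h3)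
      exact_mod_cast this
    calc K * ρ ^ (2 * m) * ((2 * m).factorial : ℝ)
        ≤ K * ρ ^ (2 * m) * (4 ^ m * (m.factorial : ℝ) ^ 2) := by gcongr
      _ = (√K * (2 * ρ) ^ m * m.factorial) ^ 2 := by
        rw [mul_pow, mul_pow, Real.sq_sqrt hK, mul_pow, mul_pow, pow_mul ρ, ← pow_mul 2 m 2,
          mul_comm m 2, pow_mul 2 2 m, ← pow_mul ρ m 2, mul_comm m 2, pow_mul ρ 2 m]
        norm_num
        ring
  have hsum : Summable t := by
    have hg := summable_geometric_of_lt_one (by positivity : 0 ≤ 4 * ρ) hρ4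
    have hg2 := (hg.mul_of_nonneg hg (fun n => by positivity) fun n => by positivity).mul_left √K
    refine Summable.of_norm_bounded hg2 fun p => ?_
    obtain ⟨j, q⟩ := p
    have hch : ((j + q).factorial : ℝ) / (j.factorial * q.factorial) ≤ 2 ^ (j + q) := by
      rw [← Nat.cast_add_choose]
      exact_mod_cast Nat.choose_le_two_pow _ _
    simp only [ht, norm_mul, norm_div, norm_pow, norm_neg, norm_one, one_pow, Real.norm_natCast]
    calc 1 / ((j.factorial : ℝ) * q.factorial) * ‖e (2 * (j + q))‖
        ≤ 1 / ((j.factorial : ℝ) * q.factorial) *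
          (√K * (2 * ρ) ^ (j + q) * (j + q).factorial) := by
          gcongr
          exact hem (j + q)
      _ = √K * (2 * ρ) ^ (j + q) * (((j + q).factorial : ℝ) / (j.factorial * q.factorial)) := by
          ring
      _ ≤ √K * (2 * ρ) ^ (j + q) * 2 ^ (j + q) := by gcongr
      _ = √K * ((4 * ρ) ^ j * (4 * ρ) ^ q) := by
          rw [← pow_add, mul_assoc, ← mul_pow]; ring_nf
  have h1 := tendsto_sum_weighted hsum.hasSum (le_refl 1)
  have h2 := tendsto_sum_weighted hsum.hasSum one_le_two
  -- Along j + q = l the binomial theorem gives (1-1)^l, so only l = 0 remains, with value ∫ f.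
  have h3 : ∀ l, ∑ j ∈ Finset.range (l / 1 + 1), t (j, l - 1 * j) =
      if l = 0 then e 0 else 0 := fun l => by
    have : ∀ j ∈ Finset.range (l + 1), t (j, l - 1 * j) =
        e (2 * l) / l.factorial * (1 ^ j * (-1) ^ (l - j) * (l.choose j : ℝ)) := fun j hj => by
      have hj' : j ≤ l := Nat.lt_succ_iff.1 (Finset.mem_range.1 hj)
      have e1 : j + (l - j) = l := by omega
      simp only [ht, one_mul, e1]
      rw [Nat.cast_choose ℝ hj']
      field_simp
      simp
    rw [Nat.div_one, Finset.sum_congr rfl this, ← Finset.mul_sum, ← add_pow]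
    rcases l with _ | l
    · simp
    · simp
  have h4 : ∑' p, t p = ∫ x, f x ∂gauss := by
    refine tendsto_nhds_unique h1 (tendsto_const_nhds.congr' ?_)
    filter_upwards [eventually_ge_atTop 1] with N hN
    rw [Finset.sum_congr rfl fun l _ => h3 l, Finset.sum_ite_eq' _ 0,
      if_pos (Finset.mem_range.2 hN)]
    rfl
  rw [h4] at h2
  exact h2.congr fun N => (integral_backSum hf N).symm

/-! ### Convergence to the mean in one Gaussian variable. -/

/-- This is the term estimate applied to f' in place of f. The extra factor n + 1 in (n+1)! is
absorbed by enlarging ρ to some a that is still below 1/7. -/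
theorem tendsto_integral_heatPoly_mul_derivative_sq {f : ℝ → ℝ} (hf : SmoothL2 f) {ρ K : ℝ}
    (hρ : 0 < ρ) (hρ7 : 7 * ρ < 1) (hK : 0 ≤ K)
    (hb : ∀ n, ∫ x, (deriv^[n] f x) ^ 2 ∂gauss ≤ K * ρ ^ n * n.factorial) :
    Tendsto (fun l => ∫ x, (heatPoly l x * deriv^[l + 1] f x) ^ 2 ∂gauss) atTop (𝓝 0) := by
  obtain ⟨a, ha1, ha2⟩ := exists_between (show ρ < 1 / 7 by linarith)
  have ha0 : 0 < a := hρ.trans ha1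
  obtain ⟨C, hC0, hC⟩ := exists_poly_mul_pow_le 1 hρ.le ha1
  have hb' : ∀ n, ∫ x, (deriv^[n] (deriv f) x) ^ 2 ∂gauss ≤ (K * ρ * C) * a ^ n * n.factorial := by
    intro n
    refine (hb (n + 1)).trans ?_
    rw [Nat.factorial_succ]
    push_cast
    calc K * ρ ^ (n + 1) * ((n + 1) * (n.factorial : ℝ))
        = K * ρ * (((n : ℝ) + 1) ^ 1 * ρ ^ n) * n.factorial := by ring
      _ ≤ K * ρ * (C * a ^ n) * n.factorial :=
          mul_le_mul_of_nonneg_right (mul_le_mul_of_nonneg_left (hC n) (by positivity))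
            (by positivity)
      _ = _ := by ring
  have hle := integral_heatPoly_mul_sq_le hf.derivative ha0.le (by linarith) (by positivity) hb'
  obtain ⟨c, hc1, hc2⟩ := exists_between (show 7 * a < 1 by linarith)
  obtain ⟨C', hC0', hC'⟩ := exists_poly_mul_pow_le 5 (by positivity : 0 ≤ 7 * a) hc1
  have hlim : Tendsto (fun l : ℕ => (K * ρ * C) * (C' * c ^ l)) atTop (𝓝 0) := by
    have := tendsto_pow_atTop_nhds_zero_of_lt_one (by linarith : 0 ≤ c) hc2
    simpa using (this.const_mul C').const_mul (K * ρ * C)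
  refine squeeze_zero (fun l => integral_nonneg fun x => sq_nonneg _) (fun l => ?_) hlim
  refine (hle l).trans ?_
  calc ((l : ℝ) + 1) ^ 5 * (K * ρ * C * (7 * a) ^ l)
      = K * ρ * C * (((l : ℝ) + 1) ^ 5 * (7 * a) ^ l) := by ring
    _ ≤ _ := mul_le_mul_of_nonneg_left (hC' l) (by positivity)

/-- If derivatives tend to zero in the Gaussian `L²` space, then increments tend to zero. -/
theorem tendsto_sub_of_tendsto_integral_sq {S w : ℕ → ℝ → ℝ}
    (hd : ∀ n x, HasDerivAt (S n) (w n x) x) (hw : ∀ n, Continuous (w n))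
    (hL : ∀ n, MemLp (w n) 2 gauss)
    (hlim : Tendsto (fun n => ∫ x, w n x ^ 2 ∂gauss) atTop (𝓝 0)) {z y : ℝ} (hzy : z ≤ y) :
    Tendsto (fun n => S n y - S n z) atTop (𝓝 0) := by
  obtain ⟨x₀, hx₀, hmin⟩ := isCompact_Icc.exists_isMinOn (Set.nonempty_Icc.2 hzy)
    continuous_gaussianPDFReal.continuousOn
  set c := gaussianPDFReal 0 1 x₀ with hc
  have hc0 : 0 < c := gaussianPDFReal_pos 0 1 x₀ one_ne_zero
  -- The Gaussian density is at least c > 0 on [z, y], and |w| ≤ ε + w²/ε; the first part is small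
  -- with ε, the second tends to 0 for fixed ε.
  have hbound : ∀ ε > 0, ∀ n, |S n y - S n z| ≤
      ε * (y - z) + (1 / (ε * c)) * ∫ x, w n x ^ 2 ∂gauss := by
    intro ε hε n
    rw [← intervalIntegral.integral_eq_sub_of_hasDerivAt (fun x _ => hd n x)
      ((hw n).intervalIntegrable _ _)]
    refine (intervalIntegral.abs_integral_le_integral_abs hzy).trans ?_
    have h1 : ∫ x in z..y, |w n x| ≤
        ∫ x in z..y, (ε + 1 / (ε * c) * (gaussianPDFReal 0 1 x * w n x ^ 2)) := by
      refine intervalIntegral.integral_mono_on hzy ((hw n).abs.intervalIntegrable _ _)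
        (Continuous.intervalIntegrable ?_ _ _) fun x hx => ?_
      · exact continuous_const.add (continuous_const.mul
          (continuous_gaussianPDFReal.mul ((hw n).pow 2)))
      · have h2 : c ≤ gaussianPDFReal 0 1 x := hmin hx
        have h3 : 1 / ε * |w n x| ^ 2 ≤ 1 / (ε * c) * (gaussianPDFReal 0 1 x * w n x ^ 2) := by
          rw [sq_abs]
          calc 1 / ε * w n x ^ 2 = 1 / (ε * c) * (c * w n x ^ 2) := by field_simp
            _ ≤ _ := by gcongr
        have h4 : |w n x| ≤ ε + 1 / ε * |w n x| ^ 2 := by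
          rw [← sub_nonneg]
          have : ε + 1 / ε * |w n x| ^ 2 - |w n x| =
              (1 / ε) * ((|w n x| - ε / 2) ^ 2 + 3 / 4 * ε ^ 2) := by
            field_simp; ring
          rw [this]
          positivity
        linarith
    refine h1.trans ?_
    have hci : IntervalIntegrable (fun x => gaussianPDFReal 0 1 x * w n x ^ 2) volume z y :=
      (continuous_gaussianPDFReal.mul ((hw n).pow 2)).intervalIntegrable _ _
    rw [intervalIntegral.integral_add intervalIntegrable_const (hci.const_mul _),
      intervalIntegral.integral_const, intervalIntegral.integral_const_mul, smul_eq_mul,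
      mul_comm (y - z)]
    gcongr
    rw [integral_gauss_eq, intervalIntegral.integral_of_le hzy]
    exact setIntegral_le_integral (integrable_gauss_iff.1 (hL n).integrable_sq)
      (ae_of_all _ fun x => mul_nonneg (gaussianPDFReal_nonneg 0 1 x) (sq_nonneg _))
  rw [Metric.tendsto_atTop]
  intro η hη
  set ε := η / (2 * (y - z + 1)) with hε
  have hyz : 0 < y - z + 1 := by linarith
  have hε0 : 0 < ε := by positivity
  have hl2 := hlim.const_mul (1 / (ε * c))
  rw [mul_zero] at hl2
  obtain ⟨N, hN⟩ := (hl2.eventually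
    (gt_mem_nhds (show (0 : ℝ) < η / 2 by positivity))).exists_forall_of_atTop
  refine ⟨N, fun n hn => ?_⟩
  rw [Real.dist_eq, sub_zero]
  refine (hbound ε hε0 n).trans_lt ?_
  have h5 : ε * (y - z) ≤ η / 2 := by
    have : η / 2 = ε * (y - z + 1) := by rw [hε]; field_simp
    rw [this]
    gcongr
    linarith
  linarith [hN n hn]

/-- Cauchy–Schwarz with weights b^l, chosen so that both factors remain summable when the squared
norms decay like b^{2l}. -/
theorem backSum_sub_sq_le {f : ℝ → ℝ} {b : ℝ} (hb0 : 0 < b) {N n : ℕ} (hN : N ≤ n)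
    (x : ℝ) : (backSum f n x - backSum f N x) ^ 2 ≤
      (∑ l ∈ Finset.Ico N n, b ^ l) *
        ∑ l ∈ Finset.Ico N n, (heatPoly l x * deriv^[l] f x) ^ 2 / b ^ l := by
  have h : backSum f n x - backSum f N x =
      ∑ l ∈ Finset.Ico N n, (-1) ^ l * (heatPoly l x * deriv^[l] f x) := by
    rw [Finset.sum_Ico_eq_sub _ hN]; rfl
  rw [h]
  refine Finset.sum_sq_le_sum_mul_sum_of_sq_le_mul _ (fun l _ => by positivity)
    (fun l _ => by positivity) fun l _ => le_of_eq ?_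
  rw [mul_div_cancel₀ _ (by positivity), mul_pow, ← pow_mul, mul_comm l 2, pow_mul]
  simp

theorem sum_Ico_pow_le {b : ℝ} (hb0 : 0 < b) (hb1 : b < 1) (N n : ℕ) :
    ∑ l ∈ Finset.Ico N n, b ^ l ≤ b ^ N / (1 - b) := by
  have hg := hasSum_geometric_of_lt_one hb0.le hb1
  rw [Finset.sum_Ico_eq_sum_range]
  simp_rw [pow_add, ← Finset.mul_sum]
  rw [div_eq_mul_inv]
  gcongr
  exact sum_le_hasSum _ (fun _ _ => by positivity) hg

/-- Tails of the series, in the Gaussian `L²` space. -/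
theorem integral_backSum_sub_sq_le {f : ℝ → ℝ} (hf : SmoothL2 f) {b K : ℝ} (hb0 : 0 < b)
    (hb1 : b < 1) (hK : 0 ≤ K)
    (hI : ∀ l, ∫ x, (heatPoly l x * deriv^[l] f x) ^ 2 ∂gauss ≤ K * (b ^ l) ^ 2)
    {N n : ℕ} (hN : N ≤ n) :
    ∫ x, (backSum f n x - backSum f N x) ^ 2 ∂gauss ≤ K / (1 - b) ^ 2 * (b ^ N) ^ 2 := by
  have hb1' : 0 < 1 - b := by linarith
  have hint : ∀ l, Integrable (fun x => (heatPoly l x * deriv^[l] f x) ^ 2 / b ^ l) gauss :=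
    fun l => ((hf.iterate l).heatPoly_mul l).memLp_self.integrable_sq.div_const _
  calc ∫ x, (backSum f n x - backSum f N x) ^ 2 ∂gauss
      ≤ ∫ x, (∑ l ∈ Finset.Ico N n, b ^ l) *
        ∑ l ∈ Finset.Ico N n, (heatPoly l x * deriv^[l] f x) ^ 2 / b ^ l ∂gauss := by
        refine integral_mono ((hf.backSum n).memLp_self.sub (hf.backSum N).memLp_self).integrable_sq
          ((integrable_finsetSum _ fun l _ => hint l).const_mul _)
          fun x => backSum_sub_sq_le hb0 hN x
    _ = (∑ l ∈ Finset.Ico N n, b ^ l) *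
        ∑ l ∈ Finset.Ico N n, (∫ x, (heatPoly l x * deriv^[l] f x) ^ 2 ∂gauss) / b ^ l := by
        rw [integral_const_mul, integral_finsetSum _ fun l _ => hint l]
        simp_rw [integral_div]
    _ ≤ (b ^ N / (1 - b)) * ∑ l ∈ Finset.Ico N n, K * b ^ l := by
        refine mul_le_mul (sum_Ico_pow_le hb0 hb1 N n) (Finset.sum_le_sum fun l _ => ?_)
          (Finset.sum_nonneg fun l _ => div_nonneg (integral_nonneg fun x => sq_nonneg _)
            (by positivity)) (by positivity)
        rw [div_le_iff₀ (by positivity)]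
        refine (hI l).trans (le_of_eq (by ring))
    _ ≤ (b ^ N / (1 - b)) * (K * (b ^ N / (1 - b))) := by
        rw [← Finset.mul_sum]
        gcongr
        exact sum_Ico_pow_le hb0 hb1 N n
    _ = _ := by field_simp

/-- One point of convergence is enough, since increments between points tend to 0. By Tonelli the
weighted squares t_l²/b^l are summable almost everywhere, and |t_l| ≤ t_l²/b^l + b^l. -/
theorem exists_tendsto_backSum {f : ℝ → ℝ} (hf : SmoothL2 f) {b K : ℝ} (hb0 : 0 < b)
    (hb1 : b < 1)
    (hI : ∀ l, ∫ x, (heatPoly l x * deriv^[l] f x) ^ 2 ∂gauss ≤ K * (b ^ l) ^ 2) :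
    ∃ y d, Tendsto (fun n => backSum f n y) atTop (𝓝 d) := by
  set q : ℕ → ℝ → ℝ := fun l x => (heatPoly l x * deriv^[l] f x) ^ 2 / b ^ l with hq
  have hint : ∀ l, Integrable (q l) gauss :=
    fun l => ((hf.iterate l).heatPoly_mul l).memLp_self.integrable_sq.div_const _
  have hq0 : ∀ l x, 0 ≤ q l x := fun l x => by positivity
  have hqm : ∀ l, AEMeasurable (fun x => ENNReal.ofReal (q l x)) gauss := fun l =>
    (hint l).aestronglyMeasurable.aemeasurable.ennreal_ofReal
  have hfin : ∫⁻ x, ∑' l, ENNReal.ofReal (q l x) ∂gauss ≠ ∞ := by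
    rw [lintegral_tsum hqm]
    have h1 : ∀ l, ∫⁻ x, ENNReal.ofReal (q l x) ∂gauss ≤ ENNReal.ofReal (K * b ^ l) := fun l => by
      rw [← ofReal_integral_eq_lintegral_ofReal (hint l) (ae_of_all _ (hq0 l))]
      refine ENNReal.ofReal_le_ofReal ?_
      simp only [hq]
      rw [integral_div, div_le_iff₀ (by positivity)]
      exact (hI l).trans (le_of_eq (by ring))
    exact ne_top_of_le_ne_top ((summable_geometric_of_lt_one hb0.le hb1).mul_left
      K).tsum_ofReal_ne_top (ENNReal.tsum_le_tsum h1)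
  obtain ⟨y, hy⟩ := (ae_lt_top' (AEMeasurable.tsum hqm) hfin).exists
  have hs : Summable fun l => q l y := by
    have := ENNReal.summable_toReal hy.ne
    simpa only [ENNReal.toReal_ofReal (hq0 _ _)] using this
  have hs2 : Summable fun l => (-1) ^ l * (heatPoly l y * deriv^[l] f y) := by
    refine Summable.of_norm_bounded (hs.add (summable_geometric_of_lt_one hb0.le hb1))
      fun l => ?_
    rw [norm_mul, norm_pow, norm_neg, norm_one, one_pow, one_mul, Real.norm_eq_abs]
    have hbl : 0 < b ^ l := by positivity
    have : q l y + b ^ l - |heatPoly l y * deriv^[l] f y| =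
        1 / b ^ l * ((|heatPoly l y * deriv^[l] f y| - b ^ l / 2) ^ 2 + 3 / 4 * (b ^ l) ^ 2) := by
      simp only [hq]
      rw [← sq_abs (heatPoly l y * deriv^[l] f y)]
      field_simp
      ring
    rw [← sub_nonneg, this]
    positivity
  exact ⟨y, _, hs2.hasSum.tendsto_sum_nat⟩

/-- The backward Taylor expansion in one Gaussian variable. -/
theorem lintegral_backSum_sub_sq_le {ρ : ℝ} (hρ : 0 < ρ) (hρ7 : 7 * ρ < 1) :
    ∃ C b : ℝ, 0 < C ∧ 0 < b ∧ b < 1 ∧ ∀ (f : ℝ → ℝ) (_ : SmoothL2 f) (K : ℝ) (_ : 0 ≤ K)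
      (_ : ∀ n, ∫ x, (deriv^[n] f x) ^ 2 ∂gauss ≤ K * ρ ^ n * n.factorial) (N : ℕ),
      ∫⁻ x, ENNReal.ofReal ((backSum f N x - ∫ y, f y ∂gauss) ^ 2) ∂gauss ≤
        ENNReal.ofReal (C * K * b ^ N) := by
  obtain ⟨a, ha1, ha2⟩ := exists_between hρ7
  have ha0 : 0 < a := lt_trans (by positivity) ha1
  obtain ⟨C, hC0, hC⟩ := exists_poly_mul_pow_le 5 (by positivity : 0 ≤ 7 * ρ) ha1
  set b := √a with hb
  have hb0 : 0 < b := Real.sqrt_pos.2 ha0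
  have hb1 : b < 1 := by rw [hb, Real.sqrt_lt' one_pos]; simpa using ha2
  have hb1' : 0 < 1 - b := by linarith
  have hba : ∀ l : ℕ, (b ^ l) ^ 2 = a ^ l := fun l => by
    rw [← pow_mul, mul_comm, pow_mul, hb, Real.sq_sqrt ha0.le]
  -- The constants depend on ρ alone and the bound is linear in K; this allows integration over a
  -- parameter later.
  refine ⟨C / (1 - b) ^ 2, a, by positivity, ha0, ha2, fun f hf K hK hbd N => ?_⟩
  have hI : ∀ l, ∫ x, (heatPoly l x * deriv^[l] f x) ^ 2 ∂gauss ≤ (C * K) * (b ^ l) ^ 2 :=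
    fun l => by
      refine (integral_heatPoly_mul_sq_le hf hρ.le hρ7.le hK hbd l).trans ?_
      rw [hba]
      calc ((l : ℝ) + 1) ^ 5 * (K * (7 * ρ) ^ l) = K * (((l : ℝ) + 1) ^ 5 * (7 * ρ) ^ l) := by ring
        _ ≤ K * (C * a ^ l) := mul_le_mul_of_nonneg_left (hC l) hK
        _ = _ := by ring
  obtain ⟨y₀, d, hd⟩ := exists_tendsto_backSum hf hb0 hb1 hI
  have hinc := fun {z y : ℝ} (hzy : z ≤ y) => tendsto_sub_of_tendsto_integral_sq
    (S := fun n => backSum f (n + 1))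
    (w := fun n x => (-1) ^ n * (heatPoly n x * deriv^[n + 1] f x))
    (fun n x => hasDerivAt_backSum hf n x)
    (fun n => (((hf.iterate (n + 1)).heatPoly_mul n).const_mul _).continuous)
    (fun n => (((hf.iterate (n + 1)).heatPoly_mul n).const_mul _).memLp_self)
    (by
      refine (tendsto_integral_heatPoly_mul_derivative_sq hf hρ hρ7 hK hbd).congr fun n => ?_
      congr 1
      funext x
      rw [mul_pow ((-1 : ℝ) ^ n), ← pow_mul, mul_comm n 2, pow_mul]
      simp) hzy
  have hlim : ∀ y, Tendsto (fun n => backSum f n y) atTop (𝓝 d) := fun y => by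
    rw [← tendsto_add_atTop_iff_nat 1] at hd ⊢
    rcases le_total y₀ y with h | h
    · simpa using (hinc h).add hd
    · simpa using hd.sub (hinc h)
  -- Fatou's lemma passes the uniform bound on differences of partial sums to their pointwise limit
  -- d.
  have hbound : ∀ N, ∫⁻ x, ENNReal.ofReal ((backSum f N x - d) ^ 2) ∂gauss ≤
      ENNReal.ofReal (C / (1 - b) ^ 2 * K * a ^ N) := fun N => by
    have h1 : ∀ x, ENNReal.ofReal ((backSum f N x - d) ^ 2) =
        liminf (fun n => ENNReal.ofReal ((backSum f N x - backSum f n x) ^ 2)) atTop := fun x =>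
      ((ENNReal.tendsto_ofReal ((tendsto_const_nhds.sub (hlim x)).pow 2)).liminf_eq).symm
    simp_rw [h1]
    refine (lintegral_liminf_le' fun n => ?_).trans ?_
    · exact (((hf.backSum N).continuous.sub (hf.backSum n).continuous).pow
        2).measurable.ennreal_ofReal.aemeasurable
    · refine liminf_le_of_le (by isBoundedDefault) fun B hB => ?_
      obtain ⟨n, hn, hn'⟩ := (hB.and (eventually_ge_atTop N)).exists
      refine hn.trans ?_
      have hi : Integrable (fun x => (backSum f N x - backSum f n x) ^ 2) gauss :=
        ((hf.backSum N).memLp_self.sub (hf.backSum n).memLp_self).integrable_sq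
      rw [← ofReal_integral_eq_lintegral_ofReal hi (ae_of_all _ fun x => sq_nonneg _)]
      refine ENNReal.ofReal_le_ofReal ?_
      simp_rw [← neg_sub (backSum f n _) (backSum f N _), neg_sq]
      refine (integral_backSum_sub_sq_le hf hb0 hb1 (by positivity) hI hn').trans ?_
      rw [hba]
      exact le_of_eq (by ring)
  have hdf : d = ∫ y, f y ∂gauss := by
    refine tendsto_nhds_unique ?_ (tendsto_integral_backSum hf hρ.le (by linarith) hK hbd)
    rw [tendsto_iff_norm_sub_tendsto_zero]
    have hm : ∀ n, MemLp (fun x => backSum f n x - d) 2 gauss := fun n =>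
      (hf.backSum n).memLp_self.sub (memLp_const d)
    have hsq : ∀ n, (‖∫ x, backSum f n x ∂gauss - d‖) ^ 2 ≤ C / (1 - b) ^ 2 * K * a ^ n :=
      fun n => by
        have h1 : ∫ x, backSum f n x ∂gauss - d = ∫ x, (backSum f n x - d) ∂gauss := by
          rw [integral_sub ((hf.backSum n).memLp_self.integrable one_le_two)
            (integrable_const _)]
          simp
        rw [h1, Real.norm_eq_abs, sq_abs]
        refine (sq_integral_le (hm n)).trans ?_
        have h2 := hbound n
        rw [← ofReal_integral_eq_lintegral_ofReal (hm n).integrable_sq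
          (ae_of_all _ fun x => sq_nonneg _)] at h2
        exact (ENNReal.ofReal_le_ofReal_iff (by positivity)).1 h2
    have h0 : Tendsto (fun n : ℕ => C / (1 - b) ^ 2 * K * a ^ n) atTop (𝓝 0) := by
      simpa using (tendsto_pow_atTop_nhds_zero_of_lt_one ha0.le ha2).const_mul
        (C / (1 - b) ^ 2 * K)
    have h3 := squeeze_zero (fun n => by positivity) hsq h0
    have h4 := (Real.continuous_sqrt.tendsto _).comp h3
    rw [Real.sqrt_zero] at h4
    exact h4.congr fun n => Real.sqrt_sq (norm_nonneg _)
  rw [← hdf]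
  exact hbound N

/-! ### Growth of the derivatives from the assumption on F. -/

/-- Consecutive quotients tend to 1/(2⁴·3³) = 1/432. Any rate between 1/432 and 1/7³ = 1/343 would
serve; 1/405 leaves room on both sides. -/
theorem exists_factorial_quotient_le :
    ∃ C : ℝ, 0 ≤ C ∧ ∀ j : ℕ, ((j.factorial : ℝ) ^ 7 /
      (((2 * j).factorial : ℝ) ^ 2 * (3 * j).factorial)) ≤ C * (1 / 405) ^ j := by
  set D : ℕ → ℝ := fun j => (j.factorial : ℝ) ^ 7 /
      (((2 * j).factorial : ℝ) ^ 2 * (3 * j).factorial) with hD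
  have hD0 : ∀ j, 0 ≤ D j := fun j => by positivity
  -- From 31 on the ratio is below 1/405: in the variable k = j - 31 the polynomial inequality
  -- `hkey` has only nonnegative coefficients.
  have hstep : ∀ j, 31 ≤ j → D (j + 1) ≤ 1 / 405 * D j := by
    intro j hj
    obtain ⟨k, rfl⟩ := Nat.exists_eq_add_of_le hj
    set j := 31 + k with hjk
    have e2 : ((2 * (j + 1)).factorial : ℝ) = (2 * j + 2) * (2 * j + 1) * (2 * j).factorial := by
      rw [show 2 * (j + 1) = 2 * j + 1 + 1 by ring, Nat.factorial_succ, Nat.factorial_succ]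
      push_cast
      ring
    have e3 : ((3 * (j + 1)).factorial : ℝ) =
        (3 * j + 3) * (3 * j + 2) * (3 * j + 1) * (3 * j).factorial := by
      rw [show 3 * (j + 1) = 3 * j + 1 + 1 + 1 by ring, Nat.factorial_succ, Nat.factorial_succ,
        Nat.factorial_succ]
      push_cast
      ring
    have h1 : D (j + 1) = ((j + 1 : ℝ) ^ 7 / (((2 * j + 2) * (2 * j + 1)) ^ 2 *
        ((3 * j + 3) * (3 * j + 2) * (3 * j + 1)))) * D j := by
      simp only [hD]
      rw [e2, e3, Nat.factorial_succ]
      push_cast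
      field_simp
    rw [h1]
    refine mul_le_mul_of_nonneg_right ?_ (hD0 j)
    rw [div_le_div_iff₀ (by positivity) (by norm_num)]
    have hj' : (j : ℝ) = 31 + k := by rw [hjk]; push_cast; ring
    have hkey : 405 * (j + 1 : ℝ) ^ 4 ≤ 12 * ((2 * j + 1) ^ 2 * (3 * j + 1) * (3 * j + 2)) := by
      rw [hj', ← sub_nonneg]
      ring_nf
      positivity
    calc ((j : ℝ) + 1) ^ 7 * 405 = (j + 1 : ℝ) ^ 3 * (405 * (j + 1 : ℝ) ^ 4) := by ring
      _ ≤ (j + 1 : ℝ) ^ 3 * (12 * ((2 * j + 1) ^ 2 * (3 * j + 1) * (3 * j + 2))) := by gcongr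
      _ = _ := by ring
  set C : ℝ := ∑ i ∈ Finset.range 32, D i / (1 / 405) ^ i with hC
  have hsmall : ∀ j, j < 32 → D j ≤ C * (1 / 405) ^ j := by
    intro j hj
    rw [← div_le_iff₀ (by positivity)]
    exact Finset.single_le_sum (f := fun i => D i / (1 / 405) ^ i)
      (fun i _ => by have := hD0 i; positivity) (Finset.mem_range.2 hj)
  refine ⟨C, Finset.sum_nonneg fun i _ => by have := hD0 i; positivity, fun j => ?_⟩
  rcases lt_or_ge j 32 with h | h
  · exact hsmall j h
  · induction j, h using Nat.le_induction with
    | base =>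
      refine (hstep 31 le_rfl).trans ?_
      have := hsmall 31 (by norm_num)
      rw [pow_succ]
      linarith
    | succ j hj ih =>
      refine (hstep j (by omega)).trans ?_
      rw [pow_succ]
      linarith

/-- Each summand is nonnegative, hence below a common bound B. The summand with L = 2j, i = j
controls a(3j); the neighbours i = j and i = j + 2 of L = 2j + 2 control the other residues mod 3 up
to bounded factors. -/
theorem summable_of_tendsto_weighted_sum {a : ℕ → ℝ} (ha : ∀ n, 0 ≤ a n)
    (h : Tendsto (fun L : ℕ => ∑ i ∈ Finset.range (L + 1), a (2 * L - i) * (L.choose i : ℝ) ^ 4 *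
      ((i.factorial : ℝ) / (L.factorial : ℝ) ^ 2)) atTop (𝓝 0)) :
    Summable fun n => a n / ((5 / 36) ^ n * n.factorial) := by
  obtain ⟨B, hB⟩ := h.bddAbove_range
  have hterm : ∀ L i, i ≤ L → a (2 * L - i) * (L.choose i : ℝ) ^ 4 *
      ((i.factorial : ℝ) / (L.factorial : ℝ) ^ 2) ≤ B := fun L i hi =>
    (Finset.single_le_sum (f := fun i => a (2 * L - i) * (L.choose i : ℝ) ^ 4 *
      ((i.factorial : ℝ) / (L.factorial : ℝ) ^ 2)) (fun i _ => by have := ha (2 * L - i); positivity)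
      (Finset.mem_range.2 (Nat.lt_succ_of_le hi))).trans (hB ⟨L, rfl⟩)
  have hB0 : 0 ≤ B := le_trans (by have := ha 0; positivity) (hterm 0 0 le_rfl)
  obtain ⟨C, hC0, hC⟩ := exists_factorial_quotient_le
  set D : ℕ → ℝ := fun j => (j.factorial : ℝ) ^ 7 /
      (((2 * j).factorial : ℝ) ^ 2 * (3 * j).factorial) with hD
  have hD0 : ∀ j, 0 ≤ D j := fun j => by positivity
  have hmid : ∀ j : ℕ, (((2 * (j + 1)).choose j : ℕ) : ℝ) =
      (2 * (j + 1)).factorial / (j.factorial * ((j + 2) * (j + 1) * j.factorial)) := fun j => by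
    rw [Nat.cast_choose ℝ (by omega), show 2 * (j + 1) - j = j + 1 + 1 by omega,
      Nat.factorial_succ (j + 1), Nat.factorial_succ j]
    push_cast
    ring
  have h0 : ∀ j, a (3 * j) / (3 * j).factorial ≤ B * D j := fun j => by
    have h1 := hterm (2 * j) j (by omega)
    rw [show 2 * (2 * j) - j = 3 * j by omega, Nat.cast_choose ℝ (by omega : j ≤ 2 * j),
      show 2 * j - j = j by omega] at h1
    calc a (3 * j) / (3 * j).factorial = (a (3 * j) * (((2 * j).factorial : ℝ) /
          (j.factorial * j.factorial)) ^ 4 * (j.factorial / ((2 * j).factorial : ℝ) ^ 2)) * D j := by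
          simp only [hD]; field_simp
      _ ≤ B * D j := mul_le_mul_of_nonneg_right h1 (hD0 j)
  have h1 : ∀ j, a (3 * (j + 1) + 1) / (3 * (j + 1) + 1).factorial ≤ 16 * (B * D (j + 1)) :=
    fun j => by
    have h1 := hterm (2 * (j + 1)) j (by omega)
    rw [show 2 * (2 * (j + 1)) - j = 3 * (j + 1) + 1 by omega, hmid] at h1
    have hr : ((j : ℝ) + 2) ^ 4 / (((j : ℝ) + 1) ^ 3 * (3 * j + 4)) ≤ 16 := by
      rw [div_le_iff₀ (by positivity), ← sub_nonneg]
      ring_nf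
      positivity
    calc a (3 * (j + 1) + 1) / (3 * (j + 1) + 1).factorial =
        (((j : ℝ) + 2) ^ 4 / (((j : ℝ) + 1) ^ 3 * (3 * j + 4))) *
          ((a (3 * (j + 1) + 1) * (((2 * (j + 1)).factorial : ℝ) /
            (j.factorial * ((j + 2) * (j + 1) * j.factorial))) ^ 4 *
            (j.factorial / ((2 * (j + 1)).factorial : ℝ) ^ 2)) * D (j + 1)) := by
          simp only [hD]
          rw [Nat.factorial_succ (3 * (j + 1)), Nat.factorial_succ j]
          push_cast
          field_simp
          ring
      _ ≤ 16 * (B * D (j + 1)) := by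
          have := ha (3 * (j + 1) + 1)
          have := hD0 (j + 1)
          gcongr
  have h2 : ∀ j, a (3 * j + 2) / (3 * j + 2).factorial ≤ 24 * (B * D (j + 1)) := fun j => by
    have h1 := hterm (2 * (j + 1)) (j + 2) (by omega)
    rw [show 2 * (2 * (j + 1)) - (j + 2) = 3 * j + 2 by omega,
      ← Nat.choose_symm (by omega : j + 2 ≤ 2 * (j + 1)),
      show 2 * (j + 1) - (j + 2) = j by omega, hmid] at h1
    have hr : 3 * ((j : ℝ) + 2) ^ 3 / ((j : ℝ) + 1) ^ 3 ≤ 24 := by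
      rw [div_le_iff₀ (by positivity), ← sub_nonneg]
      ring_nf
      positivity
    calc a (3 * j + 2) / (3 * j + 2).factorial =
        (3 * ((j : ℝ) + 2) ^ 3 / ((j : ℝ) + 1) ^ 3) *
          ((a (3 * j + 2) * (((2 * (j + 1)).factorial : ℝ) /
            (j.factorial * ((j + 2) * (j + 1) * j.factorial))) ^ 4 *
            ((j + 2).factorial / ((2 * (j + 1)).factorial : ℝ) ^ 2)) * D (j + 1)) := by
          simp only [hD]
          rw [show 3 * (j + 1) = 3 * j + 2 + 1 by ring, Nat.factorial_succ (3 * j + 2),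
            Nat.factorial_succ (j + 1), Nat.factorial_succ j]
          push_cast
          field_simp
          ring
      _ ≤ 24 * (B * D (j + 1)) := by
          have := ha (3 * j + 2)
          have := hD0 (j + 1)
          gcongr
  have hCr : ∀ j, B * D j ≤ B * C * (10 / 73) ^ (3 * j) := fun j => by
    rw [mul_assoc]
    refine mul_le_mul_of_nonneg_left ((hC j).trans ?_) hB0
    rw [pow_mul]
    gcongr
    norm_num
  -- The rates are 1/405 < (10/73)³ and 10/73 < 5/36, leaving the ratio 72/73. The factor 200
  -- exceeds 16 · 73/10, the worst residue class, and the `a 1` term covers n = 1, which `h1` does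
  -- not reach.
  set E : ℝ := 200 * (B * C) + 73 / 10 * a 1 with hE
  have hE0 : 0 ≤ E := by have := ha 1; positivity
  have hall : ∀ n, a n / n.factorial ≤ E * (10 / 73) ^ n := fun n => by
    have hBC : 0 ≤ B * C := by positivity
    have ha1 := ha 1
    obtain ⟨j, rfl | rfl | rfl⟩ : ∃ j, n = 3 * j ∨ n = 3 * j + 1 ∨ n = 3 * j + 2 :=
      ⟨n / 3, by omega⟩
    · refine ((h0 j).trans (hCr j)).trans ?_
      gcongr
      linarith
    · rcases j with _ | j
      · simp only [mul_zero, zero_add, Nat.factorial_one, Nat.cast_one, div_one, pow_one]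
        linarith
      · refine (h1 j).trans ?_
        have hp : (0 : ℝ) < (10 / 73) ^ (3 * (j + 1)) := by positivity
        have := hCr (j + 1)
        rw [pow_succ]
        nlinarith
    · refine (h2 j).trans ?_
      have hp : (0 : ℝ) < (10 / 73) ^ (3 * j + 2) := by positivity
      have := hCr (j + 1)
      rw [show 3 * (j + 1) = 3 * j + 2 + 1 by ring, pow_succ] at this
      nlinarith
  refine Summable.of_nonneg_of_le (fun n => by have := ha n; positivity) (fun n => ?_)
    ((summable_geometric_of_lt_one (by norm_num : (0 : ℝ) ≤ 72 / 73) (by norm_num)).mul_left E)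
  calc a n / ((5 / 36) ^ n * n.factorial) = a n / n.factorial / (5 / 36) ^ n := by
        rw [div_div, mul_comm]
    _ ≤ E * (10 / 73) ^ n / (5 / 36) ^ n := by gcongr; exact hall n
    _ = E * (72 / 73) ^ n := by
        rw [mul_div_assoc, ← div_pow]; norm_num

/-! ### Independence and conditional expectation. -/

section Independence

variable {Ω : Type*} {mΩ : MeasurableSpace Ω} {P : Measure Ω}

theorem Indep.eventuallyMeasurableSpace_left {m₁ m₂ : MeasurableSpace Ω} (h : Indep m₁ m₂ P) :
    Indep (eventuallyMeasurableSpace m₁ (ae P)) m₂ P := by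
  rw [Indep_iff] at h ⊢
  rintro t₁ t₂ ⟨t, ht, he⟩ ht₂
  rw [measure_congr he, measure_congr (he.inter (ae_eq_refl t₂))]
  exact h t t₂ ht ht₂

theorem setIntegral_eq_of_indep [IsProbabilityMeasure P] {m₁ m₂ : MeasurableSpace Ω}
    (hm₁ : m₁ ≤ mΩ) (hm₂ : m₂ ≤ mΩ) (h : Indep m₁ m₂ P) {f : Ω → ℝ}
    (hf : StronglyMeasurable[m₂] f) (hfi : Integrable f P) {A : Set Ω} (hA : MeasurableSet[m₁] A) :
    ∫ ω in A, f ω ∂P = P.real A * ∫ ω, f ω ∂P := by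
  rw [← setIntegral_condExp hm₁ hfi hA,
    setIntegral_congr_ae (g := fun _ => ∫ ω, f ω ∂P) (hm₁ _ hA)
      ((condExp_indep_eq hm₂ hm₁ hf h.symm).mono fun ω hω _ => hω)]
  simp

/-- Conditional expectation of a function of a measurable and of an independent variable. -/
theorem condExp_comp_prodMk_of_indep {Ω : Type*} {𝓖 mΩ : MeasurableSpace Ω} {P : Measure Ω}
    [IsProbabilityMeasure P] (h𝓖 : 𝓖 ≤ mΩ) {E E' : Type*} [MeasurableSpace E] [MeasurableSpace E'] {X : Ω → E} {Z : Ω → E'}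
    (hX : Measurable[𝓖] X) (hZ : Measurable Z)
    (h : Indep 𝓖 (MeasurableSpace.comap Z inferInstance) P) {Φ : E × E' → ℝ} (hΦ : Measurable Φ)
    (hi : Integrable (fun ω => Φ (X ω, Z ω)) P) :
    P[fun ω => Φ (X ω, Z ω) | 𝓖] =ᵐ[P] fun ω => ∫ z, Φ (X ω, z) ∂(P.map Z) := by
  have hX' : Measurable X := hX.mono h𝓖 le_rfl
  have hpZ : IsProbabilityMeasure (P.map Z) := Measure.isProbabilityMeasure_map hZ.aemeasurable
  have hlaw : ∀ A, MeasurableSet[𝓖] A → (P.restrict A).map (fun ω => (X ω, Z ω)) =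
      ((P.restrict A).map X).prod (P.map Z) := fun A hA => by
    refine (Measure.prod_eq fun s t hs ht => ?_).symm
    have hA' := h𝓖 _ hA
    rw [Measure.map_apply (hX'.prodMk hZ) (hs.prod ht), Measure.map_apply hX' hs,
      Measure.map_apply hZ ht, Measure.restrict_apply ((hX'.prodMk hZ) (hs.prod ht)),
      Measure.restrict_apply (hX' hs)]
    have := (Indep_iff _ _ _).1 h (X ⁻¹' s ∩ A) (Z ⁻¹' t)
      (MeasurableSet.inter (hX hs) hA) ⟨t, ht, rfl⟩
    rw [← this]
    congr 1
    ext ω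
    simp only [Set.mem_inter_iff, Set.mem_preimage, Set.mem_prod]
    tauto
  have hint : ∀ A, MeasurableSet[𝓖] A →
      Integrable Φ (((P.restrict A).map X).prod (P.map Z)) := fun A hA => by
    rw [← hlaw A hA]
    exact (integrable_map_measure hΦ.aestronglyMeasurable
      (hX'.prodMk hZ).aemeasurable).2 hi.integrableOn
  have hmeas : StronglyMeasurable fun x => ∫ z, Φ (x, z) ∂(P.map Z) :=
    hΦ.stronglyMeasurable.integral_prod_right'
  symm
  refine ae_eq_condExp_of_forall_setIntegral_eq h𝓖 hi (fun A hA _ => ?_) (fun A hA _ => ?_)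
    (StronglyMeasurable.aestronglyMeasurable (hmeas.comp_measurable hX))
  · exact (integrable_map_measure hmeas.aestronglyMeasurable hX'.aemeasurable).1
      (hint A hA).integral_prod_left
  · have h1 : ∫ ω in A, (∫ z, Φ (X ω, z) ∂(P.map Z)) ∂P =
        ∫ x, (∫ z, Φ (x, z) ∂(P.map Z)) ∂((P.restrict A).map X) :=
      (integral_map hX'.aemeasurable hmeas.aestronglyMeasurable).symm
    rw [h1, ← integral_prod _ (hint A hA), ← hlaw A hA,
      integral_map (hX'.prodMk hZ).aemeasurable hΦ.aestronglyMeasurable]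

/-- The joint law is the product of three laws, and a product measure may be swapped and
reassociated. -/
theorem indepFun_prodMk_of_indepFun_prodMk [IsProbabilityMeasure P] {E₁ E₂ E₃ : Type*}
    [MeasurableSpace E₁] [MeasurableSpace E₂] [MeasurableSpace E₃]
    {X : Ω → E₁} {Y : Ω → E₂} {Z : Ω → E₃} (hX : Measurable X) (hY : Measurable Y)
    (hZ : Measurable Z) (h : IndepFun X (fun ω => (Y ω, Z ω)) P) (h' : IndepFun Y Z P) :
    IndepFun (fun ω => (X ω, Z ω)) Y P := by
  have hpX : IsProbabilityMeasure (P.map X) := Measure.isProbabilityMeasure_map hX.aemeasurable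
  have hpY : IsProbabilityMeasure (P.map Y) := Measure.isProbabilityMeasure_map hY.aemeasurable
  have hpZ : IsProbabilityMeasure (P.map Z) := Measure.isProbabilityMeasure_map hZ.aemeasurable
  have hXZ : IndepFun X Z P := h.comp measurable_id measurable_snd
  rw [indepFun_iff_map_prod_eq_prod_map_map hX.aemeasurable (hY.prodMk hZ).aemeasurable,
    (indepFun_iff_map_prod_eq_prod_map_map hY.aemeasurable hZ.aemeasurable).1 h'] at h
  rw [indepFun_iff_map_prod_eq_prod_map_map (hX.prodMk hZ).aemeasurable hY.aemeasurable,
    (indepFun_iff_map_prod_eq_prod_map_map hX.aemeasurable hZ.aemeasurable).1 hXZ]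
  apply (MeasurableEquiv.prodAssoc (α := E₁) (β := E₃) (γ := E₂)).map_measurableEquiv_injective
  rw [Measure.prodAssoc_prod, ← Measure.prod_swap (μ := P.map Y) (ν := P.map Z)]
  have := Measure.map_prod_map (P.map X) ((P.map Y).prod (P.map Z)) measurable_id
    (measurable_swap (α := E₂) (β := E₃))
  rw [Measure.map_id] at this
  rw [this, ← h, Measure.map_map (by fun_prop) (by fun_prop),
    Measure.map_map (by fun_prop) (by fun_prop)]
  rfl

end Independence

/-! ### The usual augmentation and future increments. -/

section Brownian

variable {Ω : Type*} {mΩ : MeasurableSpace Ω} {P : Measure Ω} {W : ℝ≥0 → Ω → ℝ}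

/-- A generating event either depends on the path up to t or is null, hence almost equal to ∅.
Independence is insensitive to such changes. -/
theorem completedFiltration_le_eventuallyMeasurableSpace [P.IsComplete] (hW : IsBrownianReal W P)
    (t : ℝ≥0) : completedFiltration hW t ≤ eventuallyMeasurableSpace
      (MeasurableSpace.comap (fun ω (r : Set.Iic t) => W r ω) MeasurableSpace.pi) (ae P) := by
  refine sup_le (iSup₂_le fun s hs => ?_)
    (MeasurableSpace.generateFrom_le fun A hA => ⟨∅, @MeasurableSet.empty _ (_), ?_⟩)
  · rintro _ ⟨B, hB, rfl⟩
    exact ⟨_, ⟨(fun f : Set.Iic t → ℝ => f ⟨s, hs⟩) ⁻¹' B, measurable_pi_apply _ hB, rfl⟩,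
      ae_eq_refl _⟩
  · exact ae_eq_empty.2 hA

theorem indep_completedFiltration_shift [P.IsComplete] (hW : IsBrownianReal W P) (t : ℝ≥0) :
    Indep (completedFiltration hW t)
      (MeasurableSpace.comap (fun ω u => W (t + u) ω - W t ω) MeasurableSpace.pi) P :=
  indep_of_indep_of_le_left
    (Indep.eventuallyMeasurableSpace_left (hW.indepFun_shift t).symm)
    (completedFiltration_le_eventuallyMeasurableSpace hW t)

theorem measurable_brownianFiltration [P.IsComplete] (hW : IsBrownianReal W P) {s t : ℝ≥0}
    (hst : s ≤ t) : Measurable[brownianFiltration hW t] (W s) := by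
  have h1 : Measurable[completedFiltration hW t] (W s) :=
    measurable_iff_comap_le.2 (le_sup_of_le_left (le_iSup₂_of_le s hst le_rfl))
  exact h1.mono ((completedFiltration hW).le_rightCont t) le_rfl

/-- The increments of a Brownian motion after time `s` are independent of the usual augmentation
of its filtration at time `s`. -/
theorem indep_brownianFiltration_shift [IsProbabilityMeasure P] [P.IsComplete]
    (hW : IsBrownianReal W P) (s : ℝ≥0) :
    Indep (brownianFiltration hW s)
      (MeasurableSpace.comap (fun ω u => W (s + u) ω - W s ω) MeasurableSpace.pi) P := by
  have hmW := measurable_eval hW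
  refine indep_comap_process_of_bcf ((brownianFiltration hW).le s)
    (fun u => ((hmW (s + u)).sub (hmW s)).aemeasurable) fun A hA I f => ?_
  have hA' : ∀ t, s < t → MeasurableSet[completedFiltration hW t] A := fun t ht => by
    have h1 : (brownianFiltration hW s : MeasurableSpace Ω) ≤ completedFiltration hW t := by
      rw [brownianFiltration, Filtration.rightCont_eq]
      exact iInf₂_le t ht
    exact h1 _ hA
  set ε : ℕ → ℝ≥0 := fun n => 1 / ((n : ℝ≥0) + 1) with hε
  have hεlim : Tendsto ε atTop (𝓝 0) := tendsto_one_div_add_atTop_nhds_zero_nat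
  set Z : ℝ≥0 → Ω → (I → ℝ) := fun e ω u => W (s + e + u) ω - W (s + e) ω with hZ
  have hZm : ∀ e, Measurable (Z e) := fun e =>
    measurable_pi_lambda _ fun u => (hmW _).sub (hmW _)
  have hfm : ∀ e, AEStronglyMeasurable (fun ω => f (Z e ω)) P := fun e =>
    (f.continuous.measurable.comp (hZm e)).aestronglyMeasurable
  -- An event of the right-continuous filtration at s belongs to the completed one at s + ε, where
  -- the increments after s + ε are independent of it. Path continuity lets ε tend to 0, tested on
  -- bounded continuous functions of finitely many increments.
  have heq : ∀ n, ∫ ω in A, f (Z (ε n) ω) ∂P = P.real A * ∫ ω, f (Z (ε n) ω) ∂P := fun n => by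
    have hpos : s < s + ε n := lt_add_of_pos_right _ (by positivity)
    refine setIntegral_eq_of_indep ((completedFiltration hW).le (s + ε n)) ?_
      (indep_completedFiltration_shift hW (s + ε n)) ?_ ?_ (hA' _ hpos)
    · exact (measurable_pi_lambda _ fun u => (hmW _).sub (hmW _)).comap_le
    · refine Measurable.stronglyMeasurable (f.continuous.measurable.comp ?_)
      have h2 : Z (ε n) = (fun (g : ℝ≥0 → ℝ) (u : I) => g u) ∘
        fun ω u => W (s + ε n + u) ω - W (s + ε n) ω := rfl
      rw [h2]
      exact (measurable_pi_lambda _ fun u => measurable_pi_apply _).comp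
        (comap_measurable _)
    · exact Integrable.of_bound (hfm _) ‖f‖ (ae_of_all _ fun ω => f.norm_coe_le_norm _)
  have hae : ∀ᵐ ω ∂P, Tendsto (fun n => f (Z (ε n) ω)) atTop (𝓝 (f (Z 0 ω))) := by
    filter_upwards [hW.cont] with ω hω
    have hc : Continuous fun e => Z e ω := by
      refine continuous_pi fun u => ?_
      exact (hω.comp (by fun_prop)).sub (hω.comp (by fun_prop))
    exact ((f.continuous.comp hc).tendsto 0).comp hεlim
  have hl1 : Tendsto (fun n => ∫ ω in A, f (Z (ε n) ω) ∂P) atTop (𝓝 (∫ ω in A, f (Z 0 ω) ∂P)) :=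
    tendsto_integral_of_dominated_convergence (fun _ => ‖f‖) (fun n => (hfm _).restrict)
      (integrable_const _) (fun n => ae_of_all _ fun ω => f.norm_coe_le_norm _)
      (ae_restrict_of_ae hae)
  have hl2 : Tendsto (fun n => ∫ ω, f (Z (ε n) ω) ∂P) atTop (𝓝 (∫ ω, f (Z 0 ω) ∂P)) :=
    tendsto_integral_of_dominated_convergence (fun _ => ‖f‖) (fun n => hfm _)
      (integrable_const _) (fun n => ae_of_all _ fun ω => f.norm_coe_le_norm _) hae
  have := tendsto_nhds_unique hl1 ((hl2.const_mul (P.real A)).congr fun n => (heq n).symm)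
  simpa [hZ] using this

end Brownian

/-! ### The one-variable expansion with an independent parameter. -/

theorem memLp_two_iff_lintegral {α : Type*} {mα : MeasurableSpace α} {μ : Measure α} {f : α → ℝ}
    (hf : AEStronglyMeasurable f μ) :
    MemLp f 2 μ ↔ ∫⁻ x, ENNReal.ofReal (f x ^ 2) ∂μ < ∞ := by
  rw [memLp_two_iff_integrable_sq hf, Integrable, hasFiniteIntegral_iff_ofReal
    (ae_of_all _ fun x => sq_nonneg _)]
  exact and_iff_right (hf.pow 2)

theorem eLpNorm_two_sq {α : Type*} {mα : MeasurableSpace α} {μ : Measure α} (f : α → ℝ) :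
    eLpNorm f 2 μ ^ 2 = ∫⁻ x, ENNReal.ofReal (f x ^ 2) ∂μ := by
  have h := eLpNorm_nnreal_pow_eq_lintegral (μ := μ) (f := f) (p := 2) two_ne_zero
  simp only [NNReal.coe_ofNat, ENNReal.rpow_ofNat, ENNReal.coe_ofNat] at h
  rw [h]
  refine lintegral_congr fun x => ?_
  rw [← Real.enorm_of_nonneg (sq_nonneg (f x)), enorm_pow]

theorem measurable_heatPoly (l : ℕ) : Measurable (heatPoly l) :=
  Finset.measurable_sum _ fun _ _ => measurable_const.mul
    (Continuous.measurable (Polynomial.continuous_aeval _))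

section Fibre

variable {Ω E : Type*} {mΩ : MeasurableSpace Ω} [MeasurableSpace E] {P : Measure Ω}
  {V : Ω → E} {U : Ω → ℝ} {G : ℕ → E → ℝ → ℝ}

theorem lintegral_comp_of_indepFun [IsProbabilityMeasure P] (hV : Measurable V) (hU : Measurable U)
    (hind : IndepFun V U P) (hlaw : P.map U = gauss) {Ψ : E × ℝ → ℝ≥0∞} (hΨ : Measurable Ψ) :
    ∫⁻ ω, Ψ (V ω, U ω) ∂P = ∫⁻ v, ∫⁻ u, Ψ (v, u) ∂gauss ∂(P.map V) := by
  have := (indepFun_iff_map_prod_eq_prod_map_map hV.aemeasurable hU.aemeasurable).1 hind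
  rw [hlaw] at this
  rw [← lintegral_prod _ hΨ.aemeasurable, ← this, lintegral_map hΨ (hV.prodMk hU)]

/-- The backward Taylor expansion in one Gaussian variable, with an independent parameter. -/
theorem backSum_comp_of_indepFun [IsProbabilityMeasure P] (hV : Measurable V) (hU : Measurable U)
    (hind : IndepFun V U P) (hlaw : P.map U = gauss)
    (hG0 : ∀ v, ContDiff ℝ ((⊤ : ℕ∞) : WithTop ℕ∞) (G 0 v))
    (hGd : ∀ l v, deriv^[l] (G 0 v) = G l v)
    (hGm : ∀ l, Measurable (Function.uncurry (G l))) {ρ : ℝ} (hρ : 0 < ρ) (hρ7 : 7 * ρ < 1)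
    (hsum : ∑' n : ℕ, (∫⁻ ω, ENNReal.ofReal (G n (V ω) (U ω) ^ 2) ∂P) /
      ENNReal.ofReal (ρ ^ n * n.factorial) ≠ ∞) :
    (∀ l, ∫⁻ ω, ENNReal.ofReal ((heatPoly l (U ω) * G l (V ω) (U ω)) ^ 2) ∂P < ∞) ∧
    (∀ N, ∫⁻ ω, ENNReal.ofReal ((backSum (G 0 (V ω)) N (U ω) -
      ∫ u, G 0 (V ω) u ∂gauss) ^ 2) ∂P < ∞) ∧
    Tendsto (fun N => ∫⁻ ω, ENNReal.ofReal ((backSum (G 0 (V ω)) N (U ω) -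
      ∫ u, G 0 (V ω) u ∂gauss) ^ 2) ∂P) atTop (𝓝 0) := by
  have hsec : ∀ l v, Measurable (G l v) := fun l v => (hGm l).comp measurable_prodMk_left
  have hsqm : ∀ n, Measurable fun p : E × ℝ => ENNReal.ofReal (G n p.1 p.2 ^ 2) := fun n =>
    ((hGm n).pow_const 2).ennreal_ofReal
  -- Summing the normalized norms, rather than taking their supremum, gives a constant K(v) that
  -- dominates all orders and whose integral over v is the assumed finite sum.
  set κ : E → ℝ≥0∞ := fun v => ∑' n : ℕ, (∫⁻ u, ENNReal.ofReal (G n v u ^ 2) ∂gauss) /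
      ENNReal.ofReal (ρ ^ n * n.factorial) with hκ
  have hκm : ∀ n : ℕ, Measurable fun v => (∫⁻ u, ENNReal.ofReal (G n v u ^ 2) ∂gauss) /
      ENNReal.ofReal (ρ ^ n * n.factorial) := fun n =>
    (Measurable.lintegral_prod_right' (hsqm n)).div_const _
  have hκ_int : ∫⁻ v, κ v ∂(P.map V) ≠ ∞ := by
    refine ne_of_eq_of_ne ?_ hsum
    rw [hκ, lintegral_tsum fun n => (hκm n).aemeasurable]
    congr 1
    funext n
    simp_rw [div_eq_mul_inv]
    rw [lintegral_mul_const _ (Measurable.lintegral_prod_right' (hsqm n)),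
      ← lintegral_comp_of_indepFun hV hU hind hlaw (hsqm n)]
  have hpos : ∀ n : ℕ, 0 < ρ ^ n * n.factorial := fun n => by positivity
  have hfin : ∀ᵐ v ∂(P.map V), κ v < ∞ :=
    ae_lt_top (Measurable.tsum hκm) hκ_int
  have hbound : ∀ v, κ v < ∞ → SmoothL2 (G 0 v) ∧
      ∀ n, ∫ u, (deriv^[n] (G 0 v) u) ^ 2 ∂gauss ≤ (κ v).toReal * ρ ^ n * n.factorial := by
    intro v hv
    have h1 : ∀ n : ℕ, ∫⁻ u, ENNReal.ofReal (G n v u ^ 2) ∂gauss ≤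
        κ v * ENNReal.ofReal (ρ ^ n * n.factorial) := fun n => by
      have h2 := ENNReal.le_tsum (f := fun n : ℕ =>
        (∫⁻ u, ENNReal.ofReal (G n v u ^ 2) ∂gauss) / ENNReal.ofReal (ρ ^ n * n.factorial)) n
      exact (ENNReal.div_le_iff (ENNReal.ofReal_pos.2 (hpos n)).ne' ENNReal.ofReal_ne_top).1 h2
    have h3 : ∀ n, MemLp (G n v) 2 gauss := fun n =>
      (memLp_two_iff_lintegral (hsec n v).aestronglyMeasurable).2
        ((h1 n).trans_lt (ENNReal.mul_lt_top hv ENNReal.ofReal_lt_top))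
    refine ⟨⟨hG0 v, fun n => by rw [hGd]; exact h3 n⟩, fun n => ?_⟩
    rw [hGd, integral_eq_lintegral_of_nonneg_ae (ae_of_all _ fun u => sq_nonneg _)
      ((hsec n v).pow_const 2).aestronglyMeasurable, mul_assoc, ← ENNReal.toReal_ofReal (hpos n).le,
      ← ENNReal.toReal_mul]
    exact ENNReal.toReal_mono (ENNReal.mul_lt_top hv ENNReal.ofReal_lt_top).ne (h1 n)
  have hHm : Measurable fun v => ∫ u, G 0 v u ∂gauss :=
    (hGm 0).stronglyMeasurable.integral_prod_right.measurable
  have hbm : ∀ N, Measurable fun p : E × ℝ => backSum (G 0 p.1) N p.2 := fun N => by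
    simp only [backSum, hGd]
    exact Finset.measurable_sum _ fun l _ => measurable_const.mul
      (((measurable_heatPoly l).comp measurable_snd).mul (hGm l))
  obtain ⟨C, b, hC0, hb0, hb1, hmain⟩ := lintegral_backSum_sub_sq_le hρ hρ7
  have hle : ∀ N, ∫⁻ ω, ENNReal.ofReal ((backSum (G 0 (V ω)) N (U ω) -
      ∫ u, G 0 (V ω) u ∂gauss) ^ 2) ∂P ≤ ENNReal.ofReal (C * b ^ N) * ∫⁻ v, κ v ∂(P.map V) := by
    intro N
    rw [lintegral_comp_of_indepFun hV hU hind hlaw (Ψ := fun p =>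
      ENNReal.ofReal ((backSum (G 0 p.1) N p.2 - ∫ u, G 0 p.1 u ∂gauss) ^ 2))
      (((hbm N).sub (hHm.comp measurable_fst)).pow_const 2).ennreal_ofReal,
      ← lintegral_const_mul _ (Measurable.tsum hκm)]
    refine lintegral_mono_ae ?_
    filter_upwards [hfin] with v hv
    refine (hmain _ (hbound v hv).1 _ ENNReal.toReal_nonneg (hbound v hv).2 N).trans ?_
    rw [show C * (κ v).toReal * b ^ N = C * b ^ N * (κ v).toReal by ring,
      ENNReal.ofReal_mul (by positivity), ENNReal.ofReal_toReal hv.ne]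
  refine ⟨fun l => ?_, fun N => (hle N).trans_lt
    (ENNReal.mul_lt_top ENNReal.ofReal_lt_top hκ_int.lt_top), ?_⟩
  · rw [lintegral_comp_of_indepFun hV hU hind hlaw (Ψ := fun p =>
      ENNReal.ofReal ((heatPoly l p.2 * G l p.1 p.2) ^ 2))
      ((((measurable_heatPoly l).comp measurable_snd).mul (hGm l)).pow_const 2).ennreal_ofReal]
    refine lt_of_le_of_lt (b := ENNReal.ofReal (((l : ℝ) + 1) ^ 5 * (7 * ρ) ^ l) *
      ∫⁻ v, κ v ∂(P.map V)) ?_ (ENNReal.mul_lt_top ENNReal.ofReal_lt_top hκ_int.lt_top)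
    rw [← lintegral_const_mul _ (Measurable.tsum hκm)]
    refine lintegral_mono_ae ?_
    filter_upwards [hfin] with v hv
    obtain ⟨hs, hb⟩ := hbound v hv
    rw [← hGd l v, ← ofReal_integral_eq_lintegral_ofReal
      ((hs.iterate l).heatPoly_mul l).memLp_self.integrable_sq (ae_of_all _ fun u => sq_nonneg _)]
    refine (ENNReal.ofReal_le_ofReal (integral_heatPoly_mul_sq_le hs hρ.le hρ7.le
      ENNReal.toReal_nonneg hb l)).trans ?_
    rw [show ((l : ℝ) + 1) ^ 5 * ((κ v).toReal * (7 * ρ) ^ l) =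
      ((l : ℝ) + 1) ^ 5 * (7 * ρ) ^ l * (κ v).toReal by ring,
      ENNReal.ofReal_mul (by positivity), ENNReal.ofReal_toReal hv.ne]
  · refine tendsto_of_tendsto_of_tendsto_of_le_of_le tendsto_const_nhds ?_
      (fun N => zero_le) hle
    have h1 : Tendsto (fun N : ℕ => C * b ^ N) atTop (𝓝 0) := by
      simpa using (tendsto_pow_atTop_nhds_zero_of_lt_one hb0.le hb1).const_mul C
    have h2 := ENNReal.Tendsto.mul_const (ENNReal.tendsto_ofReal h1)
      (Or.inr hκ_int)
    simpa using h2

end Fibre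

/-! ### Malliavin derivatives as directional derivatives. -/

section Malliavin

variable {M : ℕ}

/-- The direction in which the Malliavin derivative at time `(m + 1) Δ` differentiates. -/
def tailVec (M m : ℕ) : Fin M → ℝ := fun k => if m ≤ (k : ℕ) then 1 else 0

theorem malliavin_eq_fderiv {Δ : ℝ≥0} (hΔ : 0 < Δ) (m : ℕ) (g : (Fin M → ℝ) → ℝ) :
    malliavin Δ ((m + 1 : ℕ) * Δ) g = fun x => fderiv ℝ g x (tailVec M m) := by
  funext x
  refine Eq.trans ?_
    (LinearMap.pi_apply_eq_sum_univ (fderiv ℝ g x).toLinearMap (tailVec M m)).symm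
  refine Finset.sum_congr rfl fun k _ => ?_
  have h1 : (Pi.single k 1 : Fin M → ℝ) = fun j => if k = j then 1 else 0 := by
    funext j
    simp [Pi.single_apply, eq_comm]
  -- Coordinate k is observed at (k+1)Δ, so the indicator at the closed endpoint (m+1)Δ equals 1
  -- exactly when m ≤ k.
  have h2 : ((m + 1 : ℕ) : ℝ≥0) * Δ ∈ Set.Icc 0 ((((k : ℕ) + 1 : ℕ) : ℝ≥0) * Δ) ↔ m ≤ (k : ℕ) := by
    rw [Set.mem_Icc, and_iff_right zero_le, mul_le_mul_iff_left₀ hΔ, Nat.cast_le]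
    omega
  rw [h1, Set.indicator_apply, tailVec, smul_eq_mul, mul_comm]
  simp only [h2]
  rfl

theorem contDiff_iterate_malliavin {Δ : ℝ≥0} (hΔ : 0 < Δ) (m : ℕ) {g : (Fin M → ℝ) → ℝ}
    (hg : ContDiff ℝ ((⊤ : ℕ∞) : WithTop ℕ∞) g) (l : ℕ) :
    ContDiff ℝ ((⊤ : ℕ∞) : WithTop ℕ∞) ((malliavin Δ ((m + 1 : ℕ) * Δ))^[l] g) := by
  induction l with
  | zero => exact hg
  | succ l ih =>
    rw [Function.iterate_succ_apply', malliavin_eq_fderiv hΔ]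
    exact (ih.fderiv_right le_rfl).clm_apply contDiff_const

theorem iterate_deriv_comp_line {Δ : ℝ≥0} (hΔ : 0 < Δ) (m : ℕ) {g : (Fin M → ℝ) → ℝ}
    (hg : ContDiff ℝ ((⊤ : ℕ∞) : WithTop ℕ∞) g) (c : ℝ) (v : Fin M → ℝ) (l : ℕ) :
    deriv^[l] (fun u : ℝ => g (v + (c * u) • tailVec M m)) =
      fun u => c ^ l * (malliavin Δ ((m + 1 : ℕ) * Δ))^[l] g (v + (c * u) • tailVec M m) := by
  induction l with
  | zero => funext u; simp
  | succ l ih =>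
    rw [Function.iterate_succ_apply', ih]
    funext u
    have h1 : HasDerivAt (fun u : ℝ => v + (c * u) • tailVec M m) (c • tailVec M m) u := by
      have := (((hasDerivAt_id u).const_mul c).smul_const (tailVec M m)).const_add v
      simpa using this
    have h2 := ((contDiff_iterate_malliavin hΔ m hg l).differentiable (by simp)
      (v + (c * u) • tailVec M m)).hasFDerivAt.comp_hasDerivAt u h1
    have h3 := (h2.const_mul (c ^ l)).deriv
    rw [Function.iterate_succ_apply', malliavin_eq_fderiv hΔ]
    refine h3.trans ?_
    rw [map_smul, smul_eq_mul]
    ring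

theorem malliavinIter_const (Δ s : ℝ≥0) (n : ℕ) (g : (Fin M → ℝ) → ℝ) :
    malliavinIter Δ (fun _ : Fin n => s) g = (malliavin Δ s)^[n] g := by
  rw [malliavinIter, List.ofFn_const]
  induction n with
  | zero => rfl
  | succ n ih => rw [List.replicate_succ, List.foldr_cons, ih, Function.iterate_succ_apply']

end Malliavin

theorem measurable_sample {Ω : Type*} {mΩ : MeasurableSpace Ω} {P : Measure Ω} [P.IsComplete]
    {W : ℝ≥0 → Ω → ℝ} (hW : IsBrownianReal W P) (Δ : ℝ≥0) (M : ℕ) : Measurable (sample W Δ M) :=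
  measurable_pi_lambda _ fun _ => measurable_eval hW _

/-- The supremum over all times dominates the value at the constant tuple with entries (m+1)Δ, which
lies in [0, MΔ] because m < M. -/
theorem InDInfty.memLp_malliavinPow {Ω : Type*} {mΩ : MeasurableSpace Ω} {P : Measure Ω}
    [P.IsComplete] {W : ℝ≥0 → Ω → ℝ} (hW : IsBrownianReal W P) {M : ℕ} {Δ : ℝ≥0} (hΔ : 0 < Δ)
    {g : (Fin M → ℝ) → ℝ} (hg : ContDiff ℝ ((⊤ : ℕ∞) : WithTop ℕ∞) g) (hF : InDInfty P W Δ g)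
    {m : ℕ} (hm : m < M) (l : ℕ) : MemLp (malliavinPow W Δ ((m + 1 : ℕ) * Δ) l g) 2 P := by
  rcases Nat.eq_zero_or_pos l with rfl | hl
  · exact hF.1
  have hmeas : AEStronglyMeasurable (malliavinPow W Δ ((m + 1 : ℕ) * Δ) l g) P :=
    ((contDiff_iterate_malliavin hΔ m hg l).continuous.measurable.comp
      (measurable_sample hW Δ M)).aestronglyMeasurable
  refine ⟨hmeas, ?_⟩
  have hs : ((m + 1 : ℕ) : ℝ≥0) * Δ ∈ Set.Icc (0 : ℝ≥0) (M * Δ) :=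
    ⟨zero_le, mul_le_mul_left (Nat.cast_le.2 hm) Δ⟩
  have h1 : eLpNorm (malliavinPow W Δ ((m + 1 : ℕ) * Δ) l g) 2 P ^ 2 < ∞ := by
    have h := eLpNorm_nnreal_pow_eq_lintegral (μ := P)
      (f := malliavinPow W Δ ((m + 1 : ℕ) * Δ) l g) (p := 2) two_ne_zero
    simp only [NNReal.coe_ofNat, ENNReal.rpow_ofNat, ENNReal.coe_ofNat] at h
    rw [h]
    refine lt_of_le_of_lt (lintegral_mono fun ω => ?_) (hF.2 l hl)
    gcongr
    refine le_trans (le_of_eq ?_) (le_iSup (fun s : Fin l → Set.Icc (0 : ℝ≥0) (M * Δ) =>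
      ‖malliavinIter Δ (fun i => (s i : ℝ≥0)) g (sample W Δ M ω)‖ₑ)
      (fun _ => (⟨((m + 1 : ℕ) : ℝ≥0) * Δ, hs⟩ : Set.Icc (0 : ℝ≥0) (M * Δ))))
    rw [malliavinIter_const]
    rfl
  exact (ENNReal.pow_lt_top_iff.1 h1).resolve_right two_ne_zero

/-! ### Splitting the path into past, increment and future. -/

section Decomposition

variable {Ω : Type*} {mΩ : MeasurableSpace Ω} {P : Measure Ω} {W : ℝ≥0 → Ω → ℝ}

/-- The path sampled before time `m Δ`, frozen afterwards. -/
def pastSample (W : ℝ≥0 → Ω → ℝ) (Δ : ℝ≥0) (M m : ℕ) (ω : Ω) : Fin M → ℝ :=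
  fun k => W ((min ((k : ℕ) + 1) m : ℕ) * Δ) ω

/-- The increments of the sampled path after time `(m + 1) Δ`. -/
def futureSample (W : ℝ≥0 → Ω → ℝ) (Δ : ℝ≥0) (M m : ℕ) (ω : Ω) : Fin M → ℝ :=
  fun k => W ((max (k : ℕ) m + 1 : ℕ) * Δ) ω - W ((m + 1 : ℕ) * Δ) ω

/-- The increment of the sampled path between `m Δ` and `(m + 1) Δ`. -/
def increment (W : ℝ≥0 → Ω → ℝ) (Δ : ℝ≥0) (m : ℕ) (ω : Ω) : ℝ :=
  W ((m + 1 : ℕ) * Δ) ω - W ((m : ℕ) * Δ) ω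

/-- For k < m the future part vanishes and the past part is the observation itself; for k ≥ m the
three parts telescope through W(mΔ) and W((m+1)Δ). -/
theorem sample_eq (W : ℝ≥0 → Ω → ℝ) (Δ : ℝ≥0) (M m : ℕ) (ω : Ω) :
    sample W Δ M ω = pastSample W Δ M m ω + futureSample W Δ M m ω +
      increment W Δ m ω • tailVec M m := by
  funext k
  simp only [sample, pastSample, futureSample, increment, tailVec, Pi.add_apply, Pi.smul_apply,
    smul_eq_mul]
  rcases le_or_gt m (k : ℕ) with h | h
  · rw [min_eq_right (by omega), max_eq_left h, if_pos h]
    ring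
  · rw [min_eq_left (by omega), max_eq_right h.le, if_neg h.not_ge]
    ring

theorem map_increment_div (hW : IsBrownianReal W P) {Δ : ℝ≥0} (hΔ : 0 < Δ) (m : ℕ) :
    P.map (fun ω => increment W Δ m ω / √(Δ : ℝ)) = gauss := by
  have h := gaussianReal_div_const (hW.hasLaw_sub ((m + 1 : ℕ) * Δ) ((m : ℕ) * Δ)) (√(Δ : ℝ))
  refine Eq.trans h.map_eq ?_
  rw [gauss]
  congr 1
  · simp
  · ext
    have hΔ' : (0 : ℝ) < Δ := hΔ
    have h1 : dist ((((m + 1 : ℕ) : ℝ≥0) * Δ : ℝ≥0) : ℝ) ((((m : ℕ) : ℝ≥0) * Δ : ℝ≥0) : ℝ) = Δ := by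
      rw [Real.dist_eq]
      simp [add_mul]
    refine (congrArg₂ (· / ·) h1 (Real.sq_sqrt hΔ'.le)).trans (div_self hΔ'.ne')

variable [P.IsComplete]

theorem measurable_pastSample (hW : IsBrownianReal W P) (Δ : ℝ≥0) (M m : ℕ) :
    Measurable[brownianFiltration hW ((m : ℕ) * Δ)] (pastSample W Δ M m) :=
  @measurable_pi_lambda _ _ _ (_) _ _ fun _ => measurable_brownianFiltration hW
    (mul_le_mul_left (Nat.cast_le.2 (min_le_right _ _)) Δ)

theorem measurable_increment_brownianFiltration (hW : IsBrownianReal W P) (Δ : ℝ≥0) (m : ℕ) :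
    Measurable[brownianFiltration hW ((m + 1 : ℕ) * Δ)] (increment W Δ m) :=
  Measurable.sub (measurable_brownianFiltration hW le_rfl) (measurable_brownianFiltration hW
    (mul_le_mul_left (Nat.cast_le.2 (Nat.le_succ m)) Δ))

theorem measurable_increment (hW : IsBrownianReal W P) (Δ : ℝ≥0) (m : ℕ) :
    Measurable (increment W Δ m) :=
  (measurable_eval hW _).sub (measurable_eval hW _)

theorem measurable_futureSample (hW : IsBrownianReal W P) (Δ : ℝ≥0) (M m : ℕ) :
    Measurable (futureSample W Δ M m) :=
  measurable_pi_lambda _ fun _ => (measurable_eval hW _).sub (measurable_eval hW _)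

variable [IsProbabilityMeasure P]

theorem indep_futureSample (hW : IsBrownianReal W P) (Δ : ℝ≥0) (M m : ℕ) :
    Indep (brownianFiltration hW ((m + 1 : ℕ) * Δ))
      (MeasurableSpace.comap (futureSample W Δ M m) inferInstance) P := by
  refine indep_of_indep_of_le_right (indep_brownianFiltration_shift hW _) ?_
  have h : futureSample W Δ M m =
      (fun (f : ℝ≥0 → ℝ) (k : Fin M) => f ((max (k : ℕ) m - m : ℕ) * Δ)) ∘
        fun ω u => W (((m + 1 : ℕ) : ℝ≥0) * Δ + u) ω - W ((m + 1 : ℕ) * Δ) ω := by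
    funext ω k
    have e : ((m + 1 : ℕ) : ℝ≥0) * Δ + ((max (k : ℕ) m - m : ℕ) : ℝ≥0) * Δ =
        ((max (k : ℕ) m + 1 : ℕ) : ℝ≥0) * Δ := by
      rw [← add_mul, ← Nat.cast_add]
      congr 2
      omega
    simp only [futureSample, Function.comp_apply, e]
  rw [h, ← MeasurableSpace.comap_comp]
  exact MeasurableSpace.comap_mono
    (measurable_pi_lambda _ fun k => measurable_pi_apply _).comap_le

theorem indep_increment_futureSample (hW : IsBrownianReal W P) (Δ : ℝ≥0) (M m : ℕ) :
    Indep (brownianFiltration hW ((m : ℕ) * Δ))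
      (MeasurableSpace.comap (fun ω => (increment W Δ m ω, futureSample W Δ M m ω))
        inferInstance) P := by
  refine indep_of_indep_of_le_right (indep_brownianFiltration_shift hW _) ?_
  have e : ∀ j : ℕ, m ≤ j → ((m : ℕ) : ℝ≥0) * Δ + ((j - m : ℕ) : ℝ≥0) * Δ =
        ((j : ℕ) : ℝ≥0) * Δ := fun j hj => by
    rw [← add_mul, ← Nat.cast_add]
    congr 2
    omega
  have h : (fun ω => (increment W Δ m ω, futureSample W Δ M m ω)) =
      (fun (f : ℝ≥0 → ℝ) => (f ((m + 1 - m : ℕ) * Δ), fun (k : Fin M) =>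
        f ((max (k : ℕ) m + 1 - m : ℕ) * Δ) - f ((m + 1 - m : ℕ) * Δ))) ∘
        fun ω u => W (((m : ℕ) : ℝ≥0) * Δ + u) ω - W ((m : ℕ) * Δ) ω := by
    funext ω
    refine Prod.ext ?_ ?_
    · simp only [increment, Function.comp_apply, e (m + 1) (by omega)]
    · funext k
      simp only [futureSample, Function.comp_apply, e (m + 1) (by omega),
        e (max (k : ℕ) m + 1) (by omega)]
      ring
  rw [h, ← MeasurableSpace.comap_comp]
  refine MeasurableSpace.comap_mono (Measurable.comap_le ?_)
  exact (measurable_pi_apply _).prodMk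
    (measurable_pi_lambda _ fun k => (measurable_pi_apply _).sub (measurable_pi_apply _))

theorem indepFun_increment_futureSample (hW : IsBrownianReal W P) (Δ : ℝ≥0) (M m : ℕ) :
    IndepFun (increment W Δ m) (futureSample W Δ M m) P :=
  (IndepFun_iff_Indep _ _ _).2 (indep_of_indep_of_le_left (indep_futureSample hW Δ M m)
    (measurable_increment_brownianFiltration hW Δ m).comap_le)

theorem indepFun_pastSample (hW : IsBrownianReal W P) (Δ : ℝ≥0) (M m : ℕ) :
    IndepFun (pastSample W Δ M m)
      (fun ω => (increment W Δ m ω, futureSample W Δ M m ω)) P :=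
  (IndepFun_iff_Indep _ _ _).2 (indep_of_indep_of_le_left (indep_increment_futureSample hW Δ M m)
    (measurable_pastSample hW Δ M m).comap_le)

end Decomposition

/-! ### The expansion along the increment, and conditioning. -/

section Expansion

variable {Ω : Type*} {mΩ : MeasurableSpace Ω} {P : Measure Ω} {W : ℝ≥0 → Ω → ℝ}

/-- The derivatives, in the normalized increment, of a function of the sampled path. -/
def fibreDeriv {M : ℕ} (Δ : ℝ≥0) (m : ℕ) (g : (Fin M → ℝ) → ℝ) (l : ℕ) (v : Fin M → ℝ) (u : ℝ) :
    ℝ :=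
  √(Δ : ℝ) ^ l *
    (malliavin Δ ((m + 1 : ℕ) * Δ))^[l] g (v + (√(Δ : ℝ) * u) • tailVec M m)

theorem continuous_fibreDeriv {M : ℕ} {Δ : ℝ≥0} (hΔ : 0 < Δ) (m : ℕ) {g : (Fin M → ℝ) → ℝ}
    (hg : ContDiff ℝ ((⊤ : ℕ∞) : WithTop ℕ∞) g) (l : ℕ) :
    Continuous (Function.uncurry (fibreDeriv Δ m g l)) :=
  continuous_const.mul ((contDiff_iterate_malliavin hΔ m hg l).continuous.comp
    (continuous_fst.add ((continuous_const.mul continuous_snd).smul continuous_const)))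

theorem contDiff_fibreDeriv_zero {M : ℕ} (Δ : ℝ≥0) (m : ℕ) {g : (Fin M → ℝ) → ℝ}
    (hg : ContDiff ℝ ((⊤ : ℕ∞) : WithTop ℕ∞) g) (v : Fin M → ℝ) :
    ContDiff ℝ ((⊤ : ℕ∞) : WithTop ℕ∞) (fibreDeriv Δ m g 0 v) :=
  contDiff_const.mul (hg.comp
    (contDiff_const.add ((contDiff_const.mul contDiff_id).smul contDiff_const)))

theorem iterate_deriv_fibreDeriv_zero {M : ℕ} {Δ : ℝ≥0} (hΔ : 0 < Δ) (m : ℕ)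
    {g : (Fin M → ℝ) → ℝ} (hg : ContDiff ℝ ((⊤ : ℕ∞) : WithTop ℕ∞) g) (l : ℕ) (v : Fin M → ℝ) :
    deriv^[l] (fibreDeriv Δ m g 0 v) = fibreDeriv Δ m g l v := by
  have : fibreDeriv Δ m g 0 v = fun u => g (v + (√(Δ : ℝ) * u) • tailVec M m) := by
    funext u
    simp [fibreDeriv]
  rw [this, iterate_deriv_comp_line hΔ m hg]
  rfl

/-- The normalized increment between `m Δ` and `(m + 1) Δ`. -/
def normIncrement (W : ℝ≥0 → Ω → ℝ) (Δ : ℝ≥0) (m : ℕ) (ω : Ω) : ℝ :=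
  increment W Δ m ω / √(Δ : ℝ)

theorem sqrt_mul_normIncrement {Δ : ℝ≥0} (hΔ : 0 < Δ) (m : ℕ) (ω : Ω) :
    √(Δ : ℝ) * normIncrement W Δ m ω = increment W Δ m ω :=
  mul_div_cancel₀ _ (Real.sqrt_pos.2 hΔ).ne'

theorem fibreDeriv_normIncrement {Δ : ℝ≥0} (hΔ : 0 < Δ) {M : ℕ} (m : ℕ) (g : (Fin M → ℝ) → ℝ)
    (l : ℕ) (ω : Ω) :
    fibreDeriv Δ m g l (pastSample W Δ M m ω + futureSample W Δ M m ω) (normIncrement W Δ m ω) =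
      √(Δ : ℝ) ^ l * malliavinPow W Δ ((m + 1 : ℕ) * Δ) l g ω := by
  rw [fibreDeriv, sqrt_mul_normIncrement hΔ, ← sample_eq]
  rfl

theorem gammaCoeff_eq (W : ℝ≥0 → Ω → ℝ) (Δ : ℝ≥0) (m l : ℕ) (ω : Ω) :
    gammaCoeff W Δ m l ω = (-1) ^ l * √(Δ : ℝ) ^ l * heatPoly l (normIncrement W Δ m ω) := rfl

theorem gammaCoeff_mul_malliavinPow {Δ : ℝ≥0} (hΔ : 0 < Δ) {M : ℕ} (m : ℕ)
    (g : (Fin M → ℝ) → ℝ) (l : ℕ) (ω : Ω) :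
    gammaCoeff W Δ m l ω * malliavinPow W Δ ((m + 1 : ℕ) * Δ) l g ω =
      (-1) ^ l * (heatPoly l (normIncrement W Δ m ω) * fibreDeriv Δ m g l
        (pastSample W Δ M m ω + futureSample W Δ M m ω) (normIncrement W Δ m ω)) := by
  rw [fibreDeriv_normIncrement hΔ, gammaCoeff_eq]
  ring

/-- The average of a function of the sampled path over the increment between `m Δ` and
`(m + 1) Δ`. -/
def incrementMean {M : ℕ} (Δ : ℝ≥0) (m : ℕ) (g : (Fin M → ℝ) → ℝ) (v : Fin M → ℝ) : ℝ :=
  ∫ u, fibreDeriv Δ m g 0 v u ∂gauss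

theorem tsum_lintegral_fibreDeriv_ne_top {M : ℕ} {Δ : ℝ≥0} (hΔ : 0 < Δ) {m : ℕ}
    {g : (Fin M → ℝ) → ℝ}
    (hL : ∀ l, MemLp (malliavinPow W Δ ((m + 1 : ℕ) * Δ) l g) 2 P)
    (hcond : Tendsto (condSum P W Δ ((m + 1 : ℕ) * Δ) g) atTop (𝓝 0)) :
    ∑' n : ℕ, (∫⁻ ω, ENNReal.ofReal (fibreDeriv Δ m g n
        (pastSample W Δ M m ω + futureSample W Δ M m ω) (normIncrement W Δ m ω) ^ 2) ∂P) /
      ENNReal.ofReal ((5 / 36) ^ n * n.factorial) ≠ ∞ := by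
  set D : ℕ → Ω → ℝ := fun n => malliavinPow W Δ ((m + 1 : ℕ) * Δ) n g with hD
  set a : ℕ → ℝ := fun n => (eLpNorm (D n) 2 P).toReal ^ 2 * (Δ : ℝ) ^ n with ha
  have ha0 : ∀ n, 0 ≤ a n := fun n => by positivity
  have hs := summable_of_tendsto_weighted_sum ha0 (hcond.congr fun L =>
    Finset.sum_congr rfl fun i _ => by simp only [ha, hD]; ring)
  refine ne_of_eq_of_ne (tsum_congr fun n => ?_) hs.tsum_ofReal_ne_top
  rw [ENNReal.ofReal_div_of_pos (by positivity)]
  congr 1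
  have h1 : ∀ ω, ENNReal.ofReal (fibreDeriv Δ m g n
      (pastSample W Δ M m ω + futureSample W Δ M m ω) (normIncrement W Δ m ω) ^ 2) =
      ENNReal.ofReal ((Δ : ℝ) ^ n) * ENNReal.ofReal (D n ω ^ 2) := fun ω => by
    rw [fibreDeriv_normIncrement hΔ, mul_pow, ← pow_mul, mul_comm n 2, pow_mul,
      Real.sq_sqrt NNReal.zero_le_coe, ENNReal.ofReal_mul (by positivity)]
  simp_rw [h1]
  rw [lintegral_const_mul' _ _ ENNReal.ofReal_ne_top, ← eLpNorm_two_sq, ha,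
    ENNReal.ofReal_mul (by positivity), ENNReal.ofReal_pow ENNReal.toReal_nonneg,
    ENNReal.ofReal_toReal (hL n).eLpNorm_ne_top, mul_comm]

variable [P.IsComplete]

theorem measurable_normIncrement_brownianFiltration (hW : IsBrownianReal W P) (Δ : ℝ≥0) (m : ℕ) :
    Measurable[brownianFiltration hW ((m + 1 : ℕ) * Δ)] (normIncrement W Δ m) :=
  Measurable.div_const (measurable_increment_brownianFiltration hW Δ m) _

theorem measurable_normIncrement (hW : IsBrownianReal W P) (Δ : ℝ≥0) (m : ℕ) :
    Measurable (normIncrement W Δ m) :=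
  (measurable_increment hW Δ m).div_const _

variable [IsProbabilityMeasure P]

theorem indepFun_normIncrement (hW : IsBrownianReal W P) (Δ : ℝ≥0) (M m : ℕ) :
    IndepFun (fun ω => pastSample W Δ M m ω + futureSample W Δ M m ω)
      (normIncrement W Δ m) P := by
  have hX : Measurable (pastSample W Δ M m) :=
    (measurable_pastSample hW Δ M m).mono ((brownianFiltration hW).le _) le_rfl
  exact (indepFun_prodMk_of_indepFun_prodMk hX
    (measurable_increment hW Δ m) (measurable_futureSample hW Δ M m)
    (indepFun_pastSample hW Δ M m) (indepFun_increment_futureSample hW Δ M m)).comp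
    (φ := fun p => p.1 + p.2) (ψ := fun y => y / √(Δ : ℝ)) (by fun_prop) (by fun_prop)

theorem measurable_incrementMean {M : ℕ} {Δ : ℝ≥0} (hΔ : 0 < Δ) (m : ℕ) {g : (Fin M → ℝ) → ℝ}
    (hg : ContDiff ℝ ((⊤ : ℕ∞) : WithTop ℕ∞) g) : Measurable (incrementMean Δ m g) :=
  ((continuous_fibreDeriv hΔ m hg 0).measurable.stronglyMeasurable.integral_prod_right).measurable

/-- Averaging over the increment, then conditioning at time `(m + 1) Δ`, is conditioning at
time `m Δ`. -/
theorem condExp_incrementMean (hW : IsBrownianReal W P) {M : ℕ} {Δ : ℝ≥0} (hΔ : 0 < Δ) (m : ℕ)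
    {g : (Fin M → ℝ) → ℝ} (hg : ContDiff ℝ ((⊤ : ℕ∞) : WithTop ℕ∞) g)
    (hgi : Integrable (fun ω => g (sample W Δ M ω)) P)
    (hHi : Integrable (fun ω => incrementMean Δ m g
      (pastSample W Δ M m ω + futureSample W Δ M m ω)) P) :
    P[fun ω => g (sample W Δ M ω) | brownianFiltration hW ((m : ℕ) * Δ)] =ᵐ[P]
      P[fun ω => incrementMean Δ m g (pastSample W Δ M m ω + futureSample W Δ M m ω) |
        brownianFiltration hW ((m + 1 : ℕ) * Δ)] := by
  set X := pastSample W Δ M m with hXdef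
  set Y := increment W Δ m with hYdef
  set Z := futureSample W Δ M m with hZdef
  have hle := (brownianFiltration hW).le
  have hXm := measurable_pastSample hW Δ M m
  have hX : Measurable X := hXm.mono (hle _) le_rfl
  have hY : Measurable Y := measurable_increment hW Δ m
  have hZ : Measurable Z := measurable_futureSample hW Δ M m
  have hXs : Measurable[brownianFiltration hW ((m + 1 : ℕ) * Δ)] X :=
    hXm.mono ((brownianFiltration hW).mono (mul_le_mul_left (Nat.cast_le.2 (Nat.le_succ m)) Δ))
      le_rfl
  have hpY : IsProbabilityMeasure (P.map Y) := Measure.isProbabilityMeasure_map hY.aemeasurable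
  have hpZ : IsProbabilityMeasure (P.map Z) := Measure.isProbabilityMeasure_map hZ.aemeasurable
  have hYZ := (indepFun_iff_map_prod_eq_prod_map_map hY.aemeasurable hZ.aemeasurable).1
    (indepFun_increment_futureSample hW Δ M m)
  set Φ : (Fin M → ℝ) × (ℝ × (Fin M → ℝ)) → ℝ :=
    fun p => g (p.1 + p.2.2 + p.2.1 • tailVec M m) with hΦdef
  have hΦ : Measurable Φ := hg.continuous.measurable.comp (by fun_prop)
  have hF : (fun ω => g (sample W Δ M ω)) = fun ω => Φ (X ω, (Y ω, Z ω)) :=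
    funext fun ω => by rw [sample_eq W Δ M m]
  -- The Gaussian average of the normalized fibre is the average over the law of the actual
  -- increment.
  have hmean : ∀ v, incrementMean Δ m g v = ∫ y, g (v + y • tailVec M m) ∂(P.map Y) := fun v => by
    have h1 : P.map Y = gauss.map (fun u => √(Δ : ℝ) * u) := by
      have h0 : P.map (normIncrement W Δ m) = gauss := map_increment_div hW hΔ m
      rw [← h0, Measure.map_map (by fun_prop) (measurable_normIncrement hW Δ m)]
      congr 1
      funext ω
      exact (sqrt_mul_normIncrement hΔ m ω).symm
    have h2 : Continuous fun y : ℝ => g (v + y • tailVec M m) :=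
      hg.continuous.comp (by fun_prop)
    rw [h1, integral_map (by fun_prop) h2.aestronglyMeasurable, incrementMean]
    simp [fibreDeriv]
  rw [hF] at hgi ⊢
  have h1 := condExp_comp_prodMk_of_indep (hle _) hXm (hY.prodMk hZ)
    (indep_increment_futureSample hW Δ M m) hΦ hgi
  have h2 := condExp_comp_prodMk_of_indep (hle _) hXs hZ (indep_futureSample hW Δ M m)
    (Φ := fun p => incrementMean Δ m g (p.1 + p.2))
    ((measurable_incrementMean hΔ m hg).comp (measurable_fst.add measurable_snd)) hHi
  refine h1.trans (EventuallyEq.trans ?_ h2.symm)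
  have hint : Integrable Φ ((P.map X).prod (P.map fun ω => (Y ω, Z ω))) := by
    rw [← (indepFun_iff_map_prod_eq_prod_map_map hX.aemeasurable (hY.prodMk hZ).aemeasurable).1
      (indepFun_pastSample hW Δ M m)]
    exact (integrable_map_measure hΦ.aestronglyMeasurable
      (hX.prodMk (hY.prodMk hZ)).aemeasurable).2 hgi
  -- Both conditional expectations now integrate out the increment and the future with the past
  -- frozen; Fubini on almost every fibre reconciles the order of integration.
  filter_upwards [ae_of_ae_map hX.aemeasurable hint.prod_right_ae] with ω hω
  rw [hYZ] at hω ⊢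
  rw [integral_prod_symm _ hω]
  simp only [hmean, hΦdef]

theorem memLp_gammaCoeff_mul_and_tendsto (hW : IsBrownianReal W P) {M : ℕ} {Δ : ℝ≥0} (hΔ : 0 < Δ)
    {m : ℕ} {g : (Fin M → ℝ) → ℝ} (hg : ContDiff ℝ ((⊤ : ℕ∞) : WithTop ℕ∞) g)
    (hL : ∀ l, MemLp (malliavinPow W Δ ((m + 1 : ℕ) * Δ) l g) 2 P)
    (hcond : Tendsto (condSum P W Δ ((m + 1 : ℕ) * Δ) g) atTop (𝓝 0)) :
    (∀ l, MemLp (fun ω => gammaCoeff W Δ m l ω * malliavinPow W Δ ((m + 1 : ℕ) * Δ) l g ω) 2 P) ∧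
    MemLp (fun ω => incrementMean Δ m g
      (pastSample W Δ M m ω + futureSample W Δ M m ω)) 2 P ∧
    Tendsto (fun N => eLpNorm (fun ω => incrementMean Δ m g
      (pastSample W Δ M m ω + futureSample W Δ M m ω) - ∑ l ∈ Finset.range N,
        gammaCoeff W Δ m l ω * malliavinPow W Δ ((m + 1 : ℕ) * Δ) l g ω) 2 P) atTop (𝓝 0) := by
  have hX : Measurable (pastSample W Δ M m) :=
    (measurable_pastSample hW Δ M m).mono ((brownianFiltration hW).le _) le_rfl
  have hV := hX.add (measurable_futureSample hW Δ M m)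
  have hU := measurable_normIncrement hW Δ m
  obtain ⟨h1, h2, h3⟩ := backSum_comp_of_indepFun hV hU (indepFun_normIncrement hW Δ M m)
    (map_increment_div hW hΔ m) (contDiff_fibreDeriv_zero Δ m hg)
    (iterate_deriv_fibreDeriv_zero hΔ m hg)
    (fun l => (continuous_fibreDeriv hΔ m hg l).measurable) (by norm_num : (0 : ℝ) < 5 / 36)
    (by norm_num) (tsum_lintegral_fibreDeriv_ne_top hΔ hL hcond)
  refine ⟨fun l => ?_, ?_, ?_⟩
  · simp_rw [gammaCoeff_mul_malliavinPow hΔ]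
    refine MemLp.const_mul ((memLp_two_iff_lintegral ?_).2 (h1 l)) _
    exact (((measurable_heatPoly l).comp hU).mul
      ((continuous_fibreDeriv hΔ m hg l).measurable.comp (hV.prodMk hU))).aestronglyMeasurable
  · refine (memLp_two_iff_lintegral
      ((measurable_incrementMean hΔ m hg).comp hV).aestronglyMeasurable).2 ?_
    -- The empty partial sum leaves only the mean itself.
    simpa [backSum, incrementMean] using h2 0
  · have h4 := (ENNReal.continuous_rpow_const (y := 1 / 2)).tendsto 0 |>.comp h3
    rw [ENNReal.zero_rpow_of_pos (by norm_num)] at h4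
    refine h4.congr fun N => ?_
    have h5 : ∀ ω, backSum (fibreDeriv Δ m g 0
        (pastSample W Δ M m ω + futureSample W Δ M m ω)) N (normIncrement W Δ m ω) =
        ∑ l ∈ Finset.range N,
          gammaCoeff W Δ m l ω * malliavinPow W Δ ((m + 1 : ℕ) * Δ) l g ω := fun ω =>
      Finset.sum_congr rfl fun l _ => by
        rw [iterate_deriv_fibreDeriv_zero hΔ m hg, gammaCoeff_mul_malliavinPow hΔ]
    have h6 := eLpNorm_two_sq (μ := P) (fun ω => incrementMean Δ m g
      (pastSample W Δ M m ω + futureSample W Δ M m ω) - ∑ l ∈ Finset.range N,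
        gammaCoeff W Δ m l ω * malliavinPow W Δ ((m + 1 : ℕ) * Δ) l g ω)
    have h7 : ∀ x : ℝ≥0∞, (x ^ 2) ^ (1 / 2 : ℝ) = x := fun x => by
      rw [← ENNReal.rpow_natCast, ← ENNReal.rpow_mul]
      norm_num
    rw [← h7 (eLpNorm _ 2 P), h6, Function.comp_apply]
    congr 1
    refine lintegral_congr fun ω => ?_
    simp only [Pi.add_apply]
    rw [h5, ← neg_sq, neg_sub]
    rfl

/-- γ(m,l) is measurable at time (m+1)Δ, so it can be pulled out. It is unbounded, which is why
square integrability of the whole product is required. -/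
theorem bteTerm_ae_eq (hW : IsBrownianReal W P) {M : ℕ} {Δ : ℝ≥0} {m : ℕ}
    {g : (Fin M → ℝ) → ℝ} {l : ℕ}
    (hL : MemLp (malliavinPow W Δ ((m + 1 : ℕ) * Δ) l g) 2 P)
    (hγ : MemLp (fun ω => gammaCoeff W Δ m l ω * malliavinPow W Δ ((m + 1 : ℕ) * Δ) l g ω) 2 P) :
    P[fun ω => gammaCoeff W Δ m l ω * malliavinPow W Δ ((m + 1 : ℕ) * Δ) l g ω |
      brownianFiltration hW ((m + 1 : ℕ) * Δ)] =ᵐ[P] bteTerm hW Δ g m l := by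
  refine condExp_mul_of_stronglyMeasurable_left (Measurable.stronglyMeasurable ?_)
    (hγ.integrable one_le_two) (hL.integrable one_le_two)
  exact Measurable.const_mul ((measurable_heatPoly l).comp
    (measurable_normIncrement_brownianFiltration hW Δ m)) _

end Expansion

end BackwardTaylor

end

/-! ### The backward Taylor expansion. -/

theorem theorem1 {Ω : Type*} [mΩ : MeasurableSpace Ω] (P : Measure Ω) [IsProbabilityMeasure P]
    [P.IsComplete] (W : ℝ≥0 → Ω → ℝ) (hW : IsBrownianReal W P)
    (M : ℕ) (hM : 1 ≤ M) (Δ : ℝ≥0) (hΔ : 0 < Δ)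
    (g : (Fin M → ℝ) → ℝ) (hg : ContDiff ℝ ((⊤ : ℕ∞) : WithTop ℕ∞) g)
    (hF : BackwardTaylor.InDInfty P W Δ g)
    (hcond : ∀ m : ℕ, m < M →
      Tendsto (BackwardTaylor.condSum P W Δ ((m + 1 : ℕ) * Δ) g) atTop (𝓝 0)) :
    ∀ m : ℕ, m < M →
      (∀ l : ℕ, MemLp (BackwardTaylor.bteTerm hW Δ g m l) 2 P) ∧
      Tendsto (fun N : ℕ => eLpNorm (fun ω =>
          (P[fun ω' => g (BackwardTaylor.sample W Δ M ω') |
            BackwardTaylor.brownianFiltration hW ((m : ℕ) * Δ)]) ω -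
          ∑ l ∈ Finset.range N, BackwardTaylor.bteTerm hW Δ g m l ω) 2 P)
        atTop (𝓝 0) := by
  intro m hm
  have hL := fun l => hF.memLp_malliavinPow hW hΔ hg hm l
  obtain ⟨hγ, hH, hlim⟩ :=
    BackwardTaylor.memLp_gammaCoeff_mul_and_tendsto hW hΔ hg hL (hcond m hm)
  have hterm := fun l => BackwardTaylor.bteTerm_ae_eq hW (hL l) (hγ l)
  refine ⟨fun l => ((hγ l).condExp one_le_two).ae_eq (hterm l), ?_⟩
  refine tendsto_of_tendsto_of_tendsto_of_le_of_le tendsto_const_nhds hlim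
    (fun N => zero_le) fun N => ?_
  -- The error is the conditional expectation at time (m+1)Δ of the unconditioned error, so L²
  -- contraction finishes the proof.
  refine le_trans (le_of_eq (eLpNorm_congr_ae ?_)) (eLpNorm_condExp_le_eLpNorm
    (m := BackwardTaylor.brownianFiltration hW ((m + 1 : ℕ) * Δ)) _ one_le_two)
  have h1 := BackwardTaylor.condExp_incrementMean hW hΔ m hg (hF.1.integrable one_le_two)
    (hH.integrable one_le_two)
  have h2 := condExp_sub (hH.integrable one_le_two) (integrable_finsetSum (Finset.range N)
    fun l _ => (hγ l).integrable one_le_two)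
    (BackwardTaylor.brownianFiltration hW ((m + 1 : ℕ) * Δ))
  have h3 := condExp_finsetSum (s := Finset.range N)
    (fun l _ => (hγ l).integrable one_le_two)
    (BackwardTaylor.brownianFiltration hW ((m + 1 : ℕ) * Δ))
  have h4 : ∀ᵐ ω ∂P, ∀ l, _ := ae_all_iff.2 hterm
  simp only [Finset.sum_fn] at h3
  filter_upwards [h1, h2, h3, h4] with ω e1 e2 e3 e4
  refine Eq.trans ?_ e2.symm
  rw [Pi.sub_apply, e3, e1]
  simp only [e4]
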